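/- Consider an observable M/M/1 queue with two classes of customers. Customers of class $\gamma\in\{A,B\}$ arrive according to independent Poisson processes of rates $\lambda_A,\lambda_B>0$, and service times are i.i.d. exponential with rate $\mu>0$. $A$-customers have preemptive priority over $B$-customers; within each class service is first come, first served. A $\gamma$-customer receives $R_\gamma$ upon service completion and pays $C_\gamma>0$ per unit of time spent in the system, where $R_\gamma\mu\ge C_\gamma$; a customer who balks receives $0$, and one who reneges pays only the cost of the time spent. All customers are strategic and use Markov strategies. An arriving $A$-customer decides whether to join on the basis of the number $n_A$ of $A$-customers present. A $B$-customer decides, on arrival and after every later $A$-arrival or service completion, whether to join (or remain) or to balk (or renege), on the basis of the numbers $(n_A,n_B)$ of $A$- and $B$-customers ahead of her; $B$-customers revise their decisions from the front of the line to its back. Such a profile (one strategy per class) is an equilibrium if * an $A$-customer joins exactly when her expected payoff from joining is nonnegative, and * for every $(n_A,n_B)$ such that $n_A$ can arise under the strategy of the $A$-customers, a $B$-customer joins or remains exactly when her expected payoff from staying until the next such event and following her strategy afterwards is nonnegative, and she cannot gain by deviating to another joining and reneging strategy. Let $\rho_A=\lambda_A/\mu$ and $M_A^e=\lfloor R_A\mu/C_A\rfloor$.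 Let $E(M_A^e,0)$ be the expected total time spent in the system by a $B$-customer who joins with $M_A^e$ $A$-customers and no $B$-customer ahead of her and never reneges, when $A$-customers join if and only if fewer than $M_A^e$ $A$-customers are present. Put $T^e=M_A^e+V^e$, where $$V^e=\begin{cases}\left\lfloor\dfrac{1-\rho_A}{1-\rho_A^{M_A^e+1}}\left[\dfrac{R_B\mu}{C_B}-\dfrac{1}{1-\rho_A}\left(M_A^e-\dfrac{\rho_A}{1-\rho_A}\bigl(1-\rho_A^{M_A^e}\bigr)\right)\right]\right\rfloor&\text{if }\rho_A\neq1,\\[3mm]\left\lfloor\dfrac{R_B\mu}{C_B(M_A^e+1)}-\dfrac{M_A^e}{2}\right\rfloor&\text{if }\rho_A=1.\end{cases}$$ **Theorem.** Suppose that $R_B/C_B\ge E(M_A^e,0)$. Then a strategy profile is an equilibrium if and only if $A$-customers join exactly when $n_A<M_A^e$, and, in every state with $n_A\le M_A^e$, $B$-customers join or remain exactly when $n=n_A+n_B<T^e$. In particular an equilibrium exists, and in equilibrium a $B$-customer joins if and only if $n<T^e$. -/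

import Mathlib

open MeasureTheory ProbabilityTheory
open scoped ENNReal

namespace StrategicQueue

/-- Parameters of the observable M/M/1 queue with two classes of customers: the arrival rates
`lamA`, `lamB` of the two Poisson streams, the service rate `mu`, and for each class the reward
`R` for a completed service and the cost `C` per unit of time spent in the system. For either
class the reward covers the expected cost of one's own service. -/
structure Params where
  lamA : ℝ
  lamB : ℝ
  mu : ℝ
  RA : ℝ
  CA : ℝ
  RB : ℝ
  CB : ℝ
  lamA_pos : 0 < lamA
  lamB_pos : 0 < lamB
  mu_pos : 0 < mu
  CA_pos : 0 < CA
  CB_pos : 0 < CB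
  rewardA : CA ≤ RA * mu
  rewardB : CB ≤ RB * mu

/-- A strategy of the `A`-customers: `a n` says that an arriving `A`-customer joins when she finds
`n` `A`-customers in the system (by preemptive priority and FCFS nobody else is ever ahead of
her, and her position never gets worse, so she never reneges). -/
abbrev StrategyA := ℕ → Prop

/-- A strategy of the `B`-customers: `s i j` says that a `B`-customer who has `i` `A`-customers and
`j` `B`-customers ahead of her joins the queue (on arrival) or remains in it (later). -/
abbrev StrategyB := ℕ → ℕ → Prop

/-- The randomness met by a customer present in the system. `(ω k).1` is the time from the `k`-th
event to the next `A`-arrival, `(ω k).2` the time from the `k`-th event to the next service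
completion; whichever clock rings first is the next event. By lack of memory of the exponential
law, both clocks may be taken afresh at each event. Events of `B`-customers arriving later are
omitted: they queue behind the customer under consideration and never affect her. -/
abbrev Clocks := ℕ → ℝ × ℝ

/-- The time between the `k`-th event and the next one. -/
noncomputable def gap (ω : Clocks) (k : ℕ) : ℝ := min (ω k).1 (ω k).2

/-- The event that follows the `k`-th one is the arrival of an `A`-customer
(rather than a service completion). -/
def IsArrival (ω : Clocks) (k : ℕ) : Prop := (ω k).1 < (ω k).2

/-- Status of a given `B`-customer: in the system with `i` `A`-customers and `j` `B`-customers ahead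
of her, already served, or gone without service (balked or reneged). -/
inductive StatusB where
  | present (i j : ℕ) : StatusB
  | served : StatusB
  | gone : StatusB

open Classical in
/-- With `i` `A`-customers in the system and `j` `B`-customers in line behind them who all follow the
strategy `s`, the number of these `B`-customers who remain: from the front of the line to its back,
each one looks at the customers ahead of him who remain, and stays or reneges according to `s`. -/
noncomputable def remaining (s : StrategyB) (i : ℕ) : ℕ → ℕ
  | 0 => 0
  | j + 1 => if s i (remaining s i j) then remaining s i j + 1 else remaining s i j

open Classical in
/-- A `B`-customer with `i` `A`-customers and `j` `B`-customers ahead of her, all of the latter using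
the strategy `s`, revises her decision according to her own strategy `t`, after those ahead of
her have revised theirs. -/
noncomputable def review (s t : StrategyB) (i j : ℕ) : StatusB :=
  if t i (remaining s i j) then StatusB.present i (remaining s i j) else StatusB.gone

open Classical in
/-- Effect of one event on the status of a `B`-customer who uses `t`, when the `A`-customers use `a`
and the other `B`-customers use `s`. An arriving `A`-customer (who joins if `a` says so) goes ahead of
all `B`-customers; a service completion concerns the first `A`-customer if there is one, otherwise
the first `B`-customer. -/
noncomputable def stepB (a : StrategyA) (s t : StrategyB) (arrival : Prop) : StatusB → StatusB
  | .present i j =>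
      if arrival then (if a i then review s t (i + 1) j else review s t i j)
      else match i, j with
        | i' + 1, j' => review s t i' j'
        | 0, j' + 1 => review s t 0 j'
        | 0, 0 => .served
  | .served => .served
  | .gone => .gone

/-- Status of the `B`-customer after `k` events, starting from the status `x`. -/
noncomputable def pathB (a : StrategyA) (s t : StrategyB) (x : StatusB) (ω : Clocks) : ℕ → StatusB
  | 0 => x
  | k + 1 => stepB a s t (IsArrival ω k) (pathB a s t x ω k)

/-- Effect of one event on an `A`-customer: `some n` means that she is in the system with `n`
`A`-customers ahead of her, `none` that her service is completed. -/
def nextA : Option ℕ → Option ℕ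
  | some (n + 1) => some n
  | some 0 => none
  | none => none

open Classical in
/-- Status after `k` events of an `A`-customer who joins with `n` `A`-customers ahead of her; only
service completions matter to her. -/
noncomputable def pathA (n : ℕ) (ω : Clocks) : ℕ → Option ℕ
  | 0 => some n
  | k + 1 => if IsArrival ω k then pathA n ω k else nextA (pathA n ω k)

namespace Params

variable (Q : Params)

/-- The law of the clocks: all clocks are independent, those of the `A`-arrivals exponential with
rate `lamA`, those of the services exponential with rate `mu`. -/
noncomputable def law : Measure Clocks :=
  Measure.infinitePi fun _ : ℕ => (expMeasure Q.lamA).prod (expMeasure Q.mu)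

open Classical in
/-- Expected total length of the periods between events during which `inSystem` holds. -/
noncomputable def expTime (inSystem : Clocks → ℕ → Prop) : ℝ≥0∞ :=
  ∫⁻ ω, ∑' k, (if inSystem ω k then ENNReal.ofReal (gap ω k) else 0) ∂Q.law

/-- Expected total time an `A`-customer spends in the system if she joins with `n` `A`-customers
ahead of her. -/
noncomputable def expTimeA (n : ℕ) : ℝ≥0∞ :=
  Q.expTime fun ω k => pathA n ω k ≠ none

/-- Expected payoff of an `A`-customer who joins with `n` `A`-customers ahead of her. -/
noncomputable def payoffA (n : ℕ) : EReal :=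
  (Q.RA : EReal) - ((ENNReal.ofReal Q.CA * Q.expTimeA n : ℝ≥0∞) : EReal)

/-- Probability that a `B`-customer with present status `x` is eventually served. -/
noncomputable def probB (a : StrategyA) (s t : StrategyB) (x : StatusB) : ℝ≥0∞ :=
  Q.law {ω | ∃ k, pathB a s t x ω k = StatusB.served}

/-- Expected time that a `B`-customer with present status `x` spends in the system from now on. -/
noncomputable def expTimeB (a : StrategyA) (s t : StrategyB) (x : StatusB) : ℝ≥0∞ :=
  Q.expTime fun ω k => ∃ i j, pathB a s t x ω k = StatusB.present i j

/-- Expected future payoff of a `B`-customer with present status `x`. -/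
noncomputable def payoffB (a : StrategyA) (s t : StrategyB) (x : StatusB) : EReal :=
  ((ENNReal.ofReal Q.RB * Q.probB a s t x : ℝ≥0∞) : EReal)
    - ((ENNReal.ofReal Q.CB * Q.expTimeB a s t x : ℝ≥0∞) : EReal)

/-- Equilibrium in Markov strategies of the fully strategic model, customers joining or remaining
when indifferent. The conditions on the `B`-customers concern all states `(i, j)` in which the
number `i` of `A`-customers is one that can arise when the `A`-customers use `a`. -/
structure IsEquilibrium (a : StrategyA) (s : StrategyB) : Prop where
  /-- An `A`-customer joins if and only if her expected payoff from joining is nonnegative. -/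
  joinA : ∀ n, a n ↔ 0 ≤ Q.payoffA n
  /-- A `B`-customer joins (or remains) if and only if her expected payoff from being in the system
  until the next event, and following `s` from then on, is nonnegative. -/
  stayB : ∀ i j, (∀ k < i, a k) →
    (s i j ↔ 0 ≤ Q.payoffB a s s (StatusB.present i (remaining s i j)))
  /-- A `B`-customer cannot gain in any state by using a joining and reneging strategy other than
  `s`. -/
  bestB : ∀ i j, (∀ k < i, a k) → ∀ t : StrategyB,
    Q.payoffB a s t (review s t i j) ≤ Q.payoffB a s s (review s s i j)

/-- The utilization factor of the `A`-customers. -/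
noncomputable def rhoA : ℝ := Q.lamA / Q.mu

/-- Naor's threshold for the `A`-customers. -/
noncomputable def MA : ℕ := ⌊Q.RA * Q.mu / Q.CA⌋₊

/-- Expected total time in the system of a `B`-customer who joins with `i` `A`-customers and `j`
`B`-customers ahead of her, when nobody reneges and the `A`-customers join if and only if fewer
than `MA` of them are present. -/
noncomputable def fullTimeB (i j : ℕ) : ℝ≥0∞ :=
  Q.expTimeB (fun n => n < Q.MA) (fun _ _ => True) (fun _ _ => True) (StatusB.present i j)

open Classical in
/-- The number by which the threshold of the `B`-customers exceeds that of the `A`-customers. -/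
noncomputable def Ve : ℤ :=
  if Q.rhoA ≠ 1 then
    ⌊(1 - Q.rhoA) / (1 - Q.rhoA ^ (Q.MA + 1)) *
      (Q.RB * Q.mu / Q.CB
        - 1 / (1 - Q.rhoA) * (Q.MA - Q.rhoA / (1 - Q.rhoA) * (1 - Q.rhoA ^ Q.MA)))⌋
  else ⌊Q.RB * Q.mu / (Q.CB * (Q.MA + 1)) - (Q.MA : ℝ) / 2⌋

/-- The threshold of the `B`-customers, on the total number of customers ahead. -/
noncomputable def Te : ℤ := Q.MA + Q.Ve

end Params

end StrategicQueue

namespace StrategicQueue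

/-! The clocks are fresh after each event, so a customer's status is a Markov chain that moves by an
arrival with probability `p` and by a service with probability `q`. Times and probabilities then
satisfy first-step equations. An `A`-customer with `n` ahead stays `(n + 1) / mu` on average, which
forces Naor's threshold `MA` for class `A`.

For class `B`, let `tau m` be the mean time to lose one customer ahead when `m` more `A`-customers
may enter: `mu * tau (m + 1) = 1 + lamA * tau m`. Summing such times gives `stayTime`. Let `v` be
the last index with `surplus v ≥ 0`; the claimed threshold is `MA + v + 1`. A customer with at most
`v` `B`-customers ahead never meets it, so she is worth `RB - CB * stayTime i j`. Behind her, only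
the slack `k = MA + v - (i + j)` matters: it drops at arrivals, grows at services, and `-1` means
leaving with value `0`. The resulting second-order recurrence, matched at `k = MA` with the front
value, is solved by `rearValue`; this is why the threshold concerns the total number of customers.
At the threshold itself, waiting for one more event has mean `meanGap * (surplus v / tau MA - CB)`,
negative exactly because `surplus (v + 1) < 0`. Hence `value` is the payoff of the threshold
strategy (`pay_threshold`) and bounds the payoff of every deviation (`pay_le_value`), by a minimum
principle (`nonneg_of_supermean`).

Uniqueness (`IsEquilibrium.iff_of_naor`) does not use the threshold form. A customer is affected
only by the `B`-customers ahead of her; so if two equilibria agree for fewer than `j` of these,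
optimality makes their continuation values with `j` ahead equal, and the staying condition then
makes the decisions equal. -/

/-! ### Two competing exponential clocks. -/

lemma expMeasure_Ioi {r : ℝ} (hr : 0 < r) {x : ℝ} (hx : 0 ≤ x) :
    expMeasure r (Set.Ioi x) = ENNReal.ofReal (Real.exp (-(r * x))) := by
  have := isProbabilityMeasure_expMeasure hr
  have h := cdf_expMeasure_eq hr x
  rw [if_pos hx, cdf_eq_real] at h
  have h2 := probReal_compl_eq_one_sub (μ := expMeasure r) (measurableSet_Iic (a := x))
  rw [Set.compl_Iic, h] at h2
  rw [← ofReal_measureReal, h2]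
  congr 1
  ring

lemma lintegral_exp_neg_Ioi {c : ℝ} (hc : 0 < c) :
    ∫⁻ t in Set.Ioi (0 : ℝ), ENNReal.ofReal (Real.exp (-(c * t))) = ENNReal.ofReal (1 / c) := by
  simp_rw [← neg_mul]
  rw [← ofReal_integral_eq_lintegral_ofReal]
  · rw [integral_exp_mul_Ioi (by linarith)]
    congr 1
    simp
  · exact integrableOn_exp_mul_Ioi (by linarith) 0
  · exact Filter.Eventually.of_forall fun t => (Real.exp_pos _).le

lemma lintegral_min_expMeasure {a b : ℝ} (ha : 0 < a) (hb : 0 < b) :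
    ∫⁻ z, ENNReal.ofReal (min z.1 z.2) ∂((expMeasure a).prod (expMeasure b))
      = ENNReal.ofReal (1 / (a + b)) := by
  have := isProbabilityMeasure_expMeasure ha
  have := isProbabilityMeasure_expMeasure hb
  -- The layer-cake formula needs a nonnegative function; truncating at `0` does not change
  -- `ENNReal.ofReal`.
  have h0 : ∀ z : ℝ × ℝ, ENNReal.ofReal (min z.1 z.2)
      = ENNReal.ofReal (max (min z.1 z.2) 0) := fun z => by
    rcases le_total 0 (min z.1 z.2) with h | h
    · rw [max_eq_left h]
    · rw [max_eq_right h, ENNReal.ofReal_of_nonpos h, ENNReal.ofReal_zero]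
  simp_rw [h0]
  rw [lintegral_eq_lintegral_meas_lt (f := fun z : ℝ × ℝ => max (min z.1 z.2) 0) _
    (Filter.Eventually.of_forall fun z => le_max_right _ _) (by fun_prop),
    ← lintegral_exp_neg_Ioi (add_pos ha hb)]
  refine setLIntegral_congr_fun measurableSet_Ioi fun t ht => ?_
  have hset : {z : ℝ × ℝ | t < max (min z.1 z.2) 0} = Set.Ioi t ×ˢ Set.Ioi t := by
    ext z
    have : ¬ t < 0 := not_lt.mpr (le_of_lt ht)
    simp [this]
  simp only [hset]
  rw [Measure.prod_prod, expMeasure_Ioi ha (le_of_lt ht), expMeasure_Ioi hb (le_of_lt ht),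
    ← ENNReal.ofReal_mul (Real.exp_pos _).le, ← Real.exp_add]
  congr 2
  ring

lemma prod_expMeasure_lt {a b : ℝ} (ha : 0 < a) (hb : 0 < b) :
    ((expMeasure a).prod (expMeasure b)) {z | z.1 < z.2} = ENNReal.ofReal (a / (a + b)) := by
  have := isProbabilityMeasure_expMeasure ha
  have := isProbabilityMeasure_expMeasure hb
  have hm : Measurable fun x => expMeasure b (Set.Ioi x) :=
    Antitone.measurable fun x y h => measure_mono (Set.Ioi_subset_Ioi h)
  rw [Measure.prod_apply (measurableSet_lt measurable_fst measurable_snd)]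
  have hs : ∀ x : ℝ, Prod.mk x ⁻¹' {z : ℝ × ℝ | z.1 < z.2} = Set.Ioi x := fun x => rfl
  simp_rw [hs]
  have hd : expMeasure a = volume.withDensity (exponentialPDF a) := rfl
  rw [hd, lintegral_withDensity_eq_lintegral_mul _
    (f := exponentialPDF a) (measurable_exponentialPDFReal a).ennreal_ofReal hm]
  rw [← lintegral_add_compl _ (measurableSet_Ici (a := (0 : ℝ))), Set.compl_Ici,
    setLIntegral_congr_fun (g := fun _ => 0) measurableSet_Iio
      (fun x hx => by simp [exponentialPDF_of_neg hx]),
    lintegral_zero, add_zero, setLIntegral_congr Ioi_ae_eq_Ici.symm]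
  rw [div_eq_mul_one_div, ENNReal.ofReal_mul ha.le, ← lintegral_exp_neg_Ioi (add_pos ha hb),
    ← lintegral_const_mul _ (by fun_prop)]
  refine setLIntegral_congr_fun measurableSet_Ioi fun x hx => ?_
  simp only [Pi.mul_apply]
  rw [exponentialPDF_of_nonneg (le_of_lt hx), expMeasure_Ioi hb (le_of_lt hx),
    ← ENNReal.ofReal_mul (by positivity), ← ENNReal.ofReal_mul ha.le, mul_assoc, ← Real.exp_add]
  congr 3
  ring_nf

/-! ### Chains driven by the clocks, and the Markov property. -/

/-- Path of a chain driven by the clocks. -/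
def chainPath {S : Type*} (step : Prop → S → S) (x : S) (ω : Clocks) : ℕ → S
  | 0 => x
  | k + 1 => step (IsArrival ω k) (chainPath step x ω k)

/-- Clocks with a given first pair. -/
def consClock (z : ℝ × ℝ) (ω : Clocks) : Clocks
  | 0 => z
  | k + 1 => ω k

lemma measurable_consClock : Measurable fun y : (ℝ × ℝ) × Clocks => consClock y.1 y.2 := by
  refine measurable_pi_iff.mpr fun k => ?_
  cases k with
  | zero => exact measurable_fst
  | succ k => exact (measurable_pi_apply k).comp measurable_snd

lemma chainPath_consClock {S : Type*} (step : Prop → S → S) (x : S) (z : ℝ × ℝ) (ω : Clocks)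
    (k : ℕ) : chainPath step x (consClock z ω) (k + 1) = chainPath step (step (z.1 < z.2) x) ω k := by
  induction k with
  | zero => rfl
  | succ k ih =>
    rw [chainPath, ih]
    rfl

lemma measurableSet_isArrival (k : ℕ) : MeasurableSet {ω : Clocks | IsArrival ω k} :=
  measurableSet_lt (measurable_fst.comp (measurable_pi_apply k))
    (measurable_snd.comp (measurable_pi_apply k))

lemma measurable_gap (k : ℕ) : Measurable fun ω : Clocks => gap ω k :=
  (measurable_fst.comp (measurable_pi_apply k)).min (measurable_snd.comp (measurable_pi_apply k))

lemma measurableSet_chainPath {S : Type*} (step : Prop → S → S) (x : S) (k : ℕ) :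
    ∀ P : S → Prop, MeasurableSet {ω | P (chainPath step x ω k)} := by
  induction k with
  | zero => exact fun P => MeasurableSet.const (P x)
  | succ k ih =>
    intro P
    have : {ω | P (chainPath step x ω (k + 1))} =
        ({ω | IsArrival ω k} ∩ {ω | P (step True (chainPath step x ω k))}) ∪
        ({ω | IsArrival ω k}ᶜ ∩ {ω | P (step False (chainPath step x ω k))}) := by
      ext ω
      by_cases h : IsArrival ω k <;> simp [chainPath, h]
    rw [this]
    exact ((measurableSet_isArrival k).inter (ih fun y => P (step True y))).union
      ((measurableSet_isArrival k).compl.inter (ih fun y => P (step False y)))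

namespace Params

variable (Q : Params)

/-- Law of one pair of clocks. -/
noncomputable def law1 : Measure (ℝ × ℝ) := (expMeasure Q.lamA).prod (expMeasure Q.mu)

instance : IsProbabilityMeasure Q.law1 := by
  have := isProbabilityMeasure_expMeasure Q.lamA_pos
  have := isProbabilityMeasure_expMeasure Q.mu_pos
  unfold law1
  infer_instance

lemma law_eq : Q.law = Measure.infinitePi fun _ : ℕ => Q.law1 := rfl

instance : IsProbabilityMeasure Q.law := by
  rw [law_eq]
  infer_instance

/-- An i.i.d. sequence preceded by an independent pair with the same law is again such a sequence;
it suffices to compare cylinders. This is the source of every first-step equation below. -/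
lemma map_consClock : (Q.law1.prod Q.law).map (fun y => consClock y.1 y.2) = Q.law := by
  conv_rhs => rw [law_eq]
  refine Measure.eq_infinitePi _ fun s t ht => ?_
  rw [Measure.map_apply measurable_consClock (.pi s.countable_toSet fun _ _ => ht _)]
  classical
  -- Filling up with `univ` outside `s` turns the cylinder into one over an initial segment, where
  -- the factor of index `0` splits off.
  let t' : ℕ → Set (ℝ × ℝ) := fun i => if i ∈ s then t i else Set.univ
  have ht' : ∀ i, MeasurableSet (t' i) := fun i => by
    by_cases h : i ∈ s <;> simp [t', h, ht]
  obtain ⟨N, hN⟩ : ∃ N, s ⊆ Finset.range (N + 1) :=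
    ⟨s.sup id, s.subset_range_sup_succ⟩
  have hpre : (fun y : (ℝ × ℝ) × Clocks => consClock y.1 y.2) ⁻¹' (Set.pi s t)
      = t' 0 ×ˢ Set.pi (Finset.range N) fun i => t' (i + 1) := by
    ext y
    simp only [Set.mem_preimage, Set.mem_pi, Set.mem_prod, Finset.coe_range, Set.mem_Iio,
      Finset.mem_coe, t']
    constructor
    · intro h
      refine ⟨?_, fun i _ => ?_⟩
      · split_ifs with h0
        exacts [h 0 h0, trivial]
      · split_ifs with h0
        exacts [h (i + 1) h0, trivial]
    · rintro ⟨h0, h1⟩ i hi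
      cases i with
      | zero => rw [if_pos hi] at h0; exact h0
      | succ i =>
        have := h1 i (by have := Finset.mem_range.mp (hN hi); omega)
        rw [if_pos hi] at this; exact this
  rw [hpre, Measure.prod_prod, law_eq, Measure.infinitePi_pi _ fun i _ => ht' _]
  rw [mul_comm, ← Finset.prod_range_succ' (fun i => Q.law1 (t' i)),
    ← Finset.prod_subset hN]
  · exact Finset.prod_congr rfl fun i hi => by simp [t', hi]
  · intro i _ hi
    simp [t', hi]

lemma lintegral_law {F : Clocks → ℝ≥0∞} (hF : Measurable F) :
    ∫⁻ ω, F ω ∂Q.law = ∫⁻ z, ∫⁻ ω, F (consClock z ω) ∂Q.law ∂Q.law1 := by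
  conv_lhs => rw [← map_consClock]
  rw [lintegral_map hF measurable_consClock,
    lintegral_prod (fun y => F (consClock y.1 y.2))
      (hF.comp measurable_consClock).aemeasurable]

/-- Probability that the next event is an arrival. -/
noncomputable def p : ℝ := Q.lamA / (Q.lamA + Q.mu)

/-- Probability that the next event is a service completion. -/
noncomputable def q : ℝ := Q.mu / (Q.lamA + Q.mu)

/-- Mean time between events. -/
noncomputable def meanGap : ℝ := 1 / (Q.lamA + Q.mu)

lemma rate_pos : 0 < Q.lamA + Q.mu := add_pos Q.lamA_pos Q.mu_pos

lemma p_nonneg : 0 ≤ Q.p := div_nonneg Q.lamA_pos.le Q.rate_pos.le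

lemma q_nonneg : 0 ≤ Q.q := div_nonneg Q.mu_pos.le Q.rate_pos.le

lemma meanGap_pos : 0 < Q.meanGap := one_div_pos.mpr Q.rate_pos

lemma p_add_q : Q.p + Q.q = 1 := by
  rw [p, q, ← add_div, div_self Q.rate_pos.ne']

lemma lintegral_law1 (g : Prop → ℝ≥0∞) :
    ∫⁻ z, g (z.1 < z.2) ∂Q.law1
      = ENNReal.ofReal Q.p * g True + ENNReal.ofReal Q.q * g False := by
  have hA : MeasurableSet {z : ℝ × ℝ | z.1 < z.2} := measurableSet_lt measurable_fst measurable_snd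
  have hp : Q.law1 {z : ℝ × ℝ | z.1 < z.2} = ENNReal.ofReal Q.p :=
    prod_expMeasure_lt Q.lamA_pos Q.mu_pos
  have hq : Q.law1 {z : ℝ × ℝ | z.1 < z.2}ᶜ = ENNReal.ofReal Q.q := by
    rw [prob_compl_eq_one_sub hA, hp, ← ENNReal.ofReal_one, ← ENNReal.ofReal_sub _ Q.p_nonneg,
      ← Q.p_add_q, add_sub_cancel_left]
  rw [← lintegral_add_compl _ hA,
    setLIntegral_congr_fun (f := fun z => g (z.1 < z.2)) (g := fun _ => g True) hA
      (fun z hz => congrArg g (eq_true hz)),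
    setLIntegral_congr_fun (f := fun z => g (z.1 < z.2)) (g := fun _ => g False) hA.compl
      (fun z (hz : ¬ z.1 < z.2) => congrArg g (eq_false hz)), setLIntegral_const, setLIntegral_const, hp, hq,
    mul_comm, mul_comm (g False)]

/-! ### First-step analysis. -/

section Chain

variable {S : Type*} (step : Prop → S → S) (live : S → Prop)

open Classical in
/-- Expected length of the period following the `k`-th event, if the chain is then alive. -/
noncomputable def timeAt (x : S) (k : ℕ) : ℝ≥0∞ :=
  ∫⁻ ω, (if live (chainPath step x ω k) then ENNReal.ofReal (gap ω k) else 0) ∂Q.law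

/-- Expected life time of a chain. -/
noncomputable def chainTime (x : S) : ℝ≥0∞ :=
  Q.expTime fun ω k => live (chainPath step x ω k)

/-- Probability of reaching a set of states. -/
noncomputable def chainProb (goal : S → Prop) (x : S) : ℝ≥0∞ :=
  Q.law {ω | ∃ k, goal (chainPath step x ω k)}

open Classical in
lemma measurable_timeAt_integrand (x : S) (k : ℕ) : Measurable fun ω : Clocks =>
    if live (chainPath step x ω k) then ENNReal.ofReal (gap ω k) else 0 :=
  Measurable.ite (measurableSet_chainPath step x k live) (measurable_gap k).ennreal_ofReal
    measurable_const

lemma chainTime_eq_tsum (x : S) : Q.chainTime step live x = ∑' k, Q.timeAt step live x k :=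
  lintegral_tsum fun k => (measurable_timeAt_integrand step live x k).aemeasurable

open Classical in
lemma timeAt_zero (x : S) :
    Q.timeAt step live x 0 = if live x then ENNReal.ofReal Q.meanGap else 0 := by
  rw [timeAt, Q.lintegral_law (measurable_timeAt_integrand step live x 0)]
  by_cases h : live x
  · rw [if_pos h, meanGap, ← lintegral_min_expMeasure Q.lamA_pos Q.mu_pos]
    refine lintegral_congr fun z => ?_
    have h' : ∀ ω, live (chainPath step x (consClock z ω) 0) := fun _ => h
    simp only [h', if_true, gap, consClock, lintegral_const, measure_univ, mul_one]
  · have h' : ∀ z ω, ¬ live (chainPath step x (consClock z ω) 0) := fun _ _ => h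
    simp [h, h']

lemma timeAt_succ (x : S) (k : ℕ) :
    Q.timeAt step live x (k + 1) = ENNReal.ofReal Q.p * Q.timeAt step live (step True x) k
      + ENNReal.ofReal Q.q * Q.timeAt step live (step False x) k := by
  rw [timeAt, Q.lintegral_law (measurable_timeAt_integrand step live x _),
    ← Q.lintegral_law1 fun P => Q.timeAt step live (step P x) k]
  refine lintegral_congr fun z => ?_
  refine lintegral_congr fun ω => ?_
  have h : chainPath step x (consClock z ω) (k + 1) = chainPath step (step (z.1 < z.2) x) ω k :=
    chainPath_consClock step x z ω k
  rw [h]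
  rfl

open Classical in
lemma chainTime_eq (x : S) :
    Q.chainTime step live x = (if live x then ENNReal.ofReal Q.meanGap else 0)
      + (ENNReal.ofReal Q.p * Q.chainTime step live (step True x)
        + ENNReal.ofReal Q.q * Q.chainTime step live (step False x)) := by
  simp_rw [chainTime_eq_tsum]
  rw [tsum_eq_zero_add' ENNReal.summable, timeAt_zero]
  simp_rw [timeAt_succ]
  rw [ENNReal.tsum_add, ENNReal.tsum_mul_left, ENNReal.tsum_mul_left]

open Classical in
-- The expected life time is the least nonnegative solution of its first-step equation: by
-- induction, every partial sum of `timeAt` stays below a supersolution.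
lemma chainTime_le {u : S → ℝ≥0∞}
    (hu : ∀ x, (if live x then ENNReal.ofReal Q.meanGap else 0)
      + (ENNReal.ofReal Q.p * u (step True x) + ENNReal.ofReal Q.q * u (step False x)) ≤ u x)
    (x : S) : Q.chainTime step live x ≤ u x := by
  rw [chainTime_eq_tsum, ENNReal.tsum_eq_iSup_nat]
  refine iSup_le fun n => ?_
  induction n generalizing x with
  | zero => simp
  | succ n ih =>
    rw [Finset.sum_range_succ', add_comm, timeAt_zero]
    simp_rw [timeAt_succ]
    rw [Finset.sum_add_distrib, ← Finset.mul_sum, ← Finset.mul_sum]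
    refine le_trans ?_ (hu x)
    gcongr
    · exact ih _
    · exact ih _

lemma chainTime_eq_zero {x : S} (hx : ¬ live x) (hT : step True x = x) (hF : step False x = x) :
    Q.chainTime step live x = 0 := by
  have : ∀ ω k, chainPath step x ω k = x := by
    intro ω k
    induction k with
    | zero => rfl
    | succ k ih => by_cases h : IsArrival ω k <;> simp [chainPath, ih, h, hT, hF]
  simp [chainTime, expTime, this, hx]

lemma chainProb_eq_one {goal : S → Prop} {x : S} (hx : goal x) :
    Q.chainProb step goal x = 1 := by
  have : {ω : Clocks | ∃ k, goal (chainPath step x ω k)} = Set.univ :=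
    Set.eq_univ_of_forall fun ω => ⟨0, hx⟩
  rw [chainProb, this, measure_univ]

lemma chainProb_eq_zero {goal : S → Prop} {x : S} (hx : ¬ goal x) (hT : step True x = x)
    (hF : step False x = x) : Q.chainProb step goal x = 0 := by
  have : ∀ ω k, chainPath step x ω k = x := by
    intro ω k
    induction k with
    | zero => rfl
    | succ k ih => by_cases h : IsArrival ω k <;> simp [chainPath, ih, h, hT, hF]
  simp [chainProb, this, hx]

open Classical in
lemma chainProb_eq {goal : S → Prop} {x : S} (hx : ¬ goal x) :
    Q.chainProb step goal x = ENNReal.ofReal Q.p * Q.chainProb step goal (step True x)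
      + ENNReal.ofReal Q.q * Q.chainProb step goal (step False x) := by
  have hm : ∀ y, MeasurableSet {ω | ∃ k, goal (chainPath step y ω k)} := fun y => by
    rw [Set.ofPred_exists]
    exact MeasurableSet.iUnion fun k => measurableSet_chainPath step y k goal
  rw [← Q.lintegral_law1 fun P => Q.chainProb step goal (step P x), chainProb,
    ← lintegral_indicator_one (hm x), Q.lintegral_law (measurable_one.indicator (hm x))]
  refine lintegral_congr fun z => ?_
  rw [chainProb, ← lintegral_indicator_one (hm _)]
  refine lintegral_congr fun ω => ?_
  have : (∃ k, goal (chainPath step x (consClock z ω) k))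
      ↔ ∃ k, goal (chainPath step (step (z.1 < z.2) x) ω k) := by
    constructor
    · rintro ⟨k, hk⟩
      cases k with
      | zero => exact absurd hk hx
      | succ k => exact ⟨k, by rwa [← chainPath_consClock]⟩
    · rintro ⟨k, hk⟩
      exact ⟨k + 1, by rwa [chainPath_consClock]⟩
  simp only [Set.indicator, Set.mem_ofPred_eq, Pi.one_apply]
  exact if_congr this rfl rfl

end Chain

end Params

/-! ### The two classes of customers as chains. -/

open Classical in
/-- Transition of an `A`-customer. -/
noncomputable def stepA (arrival : Prop) (x : Option ℕ) : Option ℕ :=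
  if arrival then x else nextA x

lemma pathA_eq_chainPath (n : ℕ) (ω : Clocks) (k : ℕ) :
    pathA n ω k = chainPath stepA (some n) ω k := by
  induction k with
  | zero => rfl
  | succ k ih => simp only [pathA, chainPath, stepA, ih]

lemma pathB_eq_chainPath (a : StrategyA) (s t : StrategyB) (x : StatusB) (ω : Clocks) (k : ℕ) :
    pathB a s t x ω k = chainPath (stepB a s t) x ω k := by
  induction k with
  | zero => rfl
  | succ k ih => simp only [pathB, chainPath, ih]

/-- The customer is in the system. -/
def StatusB.IsPresent (x : StatusB) : Prop := ∃ i j, x = StatusB.present i j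

lemma StatusB.isPresent_present (i j : ℕ) : (StatusB.present i j).IsPresent := ⟨i, j, rfl⟩

lemma StatusB.not_isPresent_served : ¬ StatusB.served.IsPresent := by rintro ⟨_, _, h⟩; cases h

lemma StatusB.not_isPresent_gone : ¬ StatusB.gone.IsPresent := by rintro ⟨_, _, h⟩; cases h

lemma remaining_le (s : StrategyB) (i j : ℕ) : remaining s i j ≤ j := by
  induction j with
  | zero => exact le_rfl
  | succ j ih =>
    rw [remaining]
    split_ifs <;> omega

lemma remaining_congr {s s' : StrategyB} {i j : ℕ} (h : ∀ k < j, (s i k ↔ s' i k)) :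
    remaining s i j = remaining s' i j := by
  induction j with
  | zero => rfl
  | succ j ih =>
    have ih := ih fun k hk => h k (by omega)
    have h' := h _ (Nat.lt_succ_of_le (remaining_le s' i j))
    by_cases hs : s' i (remaining s' i j)
    · rw [remaining, remaining, ih, if_pos hs, if_pos (h'.mpr hs)]
    · rw [remaining, remaining, ih, if_neg hs, if_neg (mt h'.mp hs)]

section Steps

variable (a : StrategyA) (s t : StrategyB)

lemma stepB_true_of_join {i : ℕ} (h : a i) (j : ℕ) :
    stepB a s t True (.present i j) = review s t (i + 1) j := by simp [stepB, h]

lemma stepB_true_of_balk {i : ℕ} (h : ¬ a i) (j : ℕ) :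
    stepB a s t True (.present i j) = review s t i j := by simp [stepB, h]

lemma stepB_false_succ (i j : ℕ) :
    stepB a s t False (.present (i + 1) j) = review s t i j := by simp [stepB]

lemma stepB_false_zero_succ (j : ℕ) :
    stepB a s t False (.present 0 (j + 1)) = review s t 0 j := by simp [stepB]

lemma stepB_false_zero_zero : stepB a s t False (.present 0 0) = .served := by simp [stepB]

lemma stepB_served (e : Prop) : stepB a s t e .served = .served := by simp [stepB]

lemma stepB_gone (e : Prop) : stepB a s t e .gone = .gone := by simp [stepB]

end Steps

/-- Each use of the inequality raises the lower bound by `δ`, so `v ≥ min 0 (-K + n * δ)` for all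
`n`. Boundedness below on the invariant set `G` starts the iteration. -/
lemma nonneg_of_strict_supermean {S : Type*} (f g : S → S) {p q δ : ℝ} (hp : 0 ≤ p) (hq : 0 ≤ q)
    (hpq : p + q = 1) (hδ : 0 < δ) (live G : S → Prop) (hG : ∀ x, G x → G (f x) ∧ G (g x))
    {v : S → ℝ} {K : ℝ} (hK : ∀ x, G x → -K ≤ v x) (h0 : ∀ x, G x → ¬ live x → 0 ≤ v x)
    (h : ∀ x, G x → live x → δ + (p * v (f x) + q * v (g x)) ≤ v x) {x : S} (hx : G x) :
    0 ≤ v x := by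
  have key : ∀ n : ℕ, ∀ x, G x → min 0 (-K + n * δ) ≤ v x := by
    intro n
    induction n with
    | zero =>
      intro x hx
      simpa using Or.inr (hK x hx)
    | succ n ih =>
      intro x hx
      by_cases hl : live x
      · have h1 := mul_le_mul_of_nonneg_left (ih _ (hG x hx).1) hp
        have h2 := mul_le_mul_of_nonneg_left (ih _ (hG x hx).2) hq
        have h3 : p * min 0 (-K + n * δ) + q * min 0 (-K + n * δ) = min 0 (-K + n * δ) := by
          rw [← add_mul, hpq, one_mul]
        have h4 : min 0 (-K + ((n + 1 : ℕ) : ℝ) * δ) ≤ δ + min 0 (-K + n * δ) := by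
          rw [← min_add_add_left]
          push_cast
          exact min_le_min (by linarith) (by linarith)
        linarith [h x hx hl]
      · exact (min_le_left _ _).trans (h0 x hx hl)
  obtain ⟨n, hn⟩ := exists_nat_gt (K / δ)
  rw [div_lt_iff₀ hδ] at hn
  have := key n x hx
  rwa [min_eq_left (by linarith)] at this

namespace Params

variable (Q : Params)

lemma toReal_ofReal_mul_add {a b : ℝ} (ha : 0 ≤ a) (hb : 0 ≤ b) {x y : ℝ≥0∞} (hx : x ≠ ⊤)
    (hy : y ≠ ⊤) : (ENNReal.ofReal a * x + ENNReal.ofReal b * y).toReal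
      = a * x.toReal + b * y.toReal := by
  rw [ENNReal.toReal_add (ENNReal.mul_ne_top ENNReal.ofReal_ne_top hx)
    (ENNReal.mul_ne_top ENNReal.ofReal_ne_top hy), ENNReal.toReal_mul, ENNReal.toReal_mul,
    ENNReal.toReal_ofReal ha, ENNReal.toReal_ofReal hb]

section Chain

variable {S : Type*} (step : Prop → S → S) (live : S → Prop)

open Classical in
lemma chainTime_le_ofReal {u : S → ℝ} (h0 : ∀ x, 0 ≤ u x)
    (hu : ∀ x, (if live x then Q.meanGap else 0)
      + (Q.p * u (step True x) + Q.q * u (step False x)) ≤ u x)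
    (x : S) : Q.chainTime step live x ≤ ENNReal.ofReal (u x) := by
  refine Q.chainTime_le step live (u := fun x => ENNReal.ofReal (u x)) (fun x => ?_) x
  have e : (if live x then ENNReal.ofReal Q.meanGap else 0)
      = ENNReal.ofReal (if live x then Q.meanGap else 0) := by
    split_ifs <;> simp
  rw [e, ← ENNReal.ofReal_mul Q.p_nonneg, ← ENNReal.ofReal_mul Q.q_nonneg,
    ← ENNReal.ofReal_add (mul_nonneg Q.p_nonneg (h0 _)) (mul_nonneg Q.q_nonneg (h0 _)),
    ← ENNReal.ofReal_add]
  · exact ENNReal.ofReal_le_ofReal (hu x)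
  · split_ifs
    exacts [Q.meanGap_pos.le, le_rfl]
  · exact add_nonneg (mul_nonneg Q.p_nonneg (h0 _)) (mul_nonneg Q.q_nonneg (h0 _))

lemma toReal_chainTime (hfin : ∀ x, Q.chainTime step live x ≠ ⊤) {x : S} (hx : live x) :
    (Q.chainTime step live x).toReal = Q.meanGap
      + (Q.p * (Q.chainTime step live (step True x)).toReal
        + Q.q * (Q.chainTime step live (step False x)).toReal) := by
  conv_lhs => rw [chainTime_eq, if_pos hx]
  rw [ENNReal.toReal_add ENNReal.ofReal_ne_top, ENNReal.toReal_ofReal Q.meanGap_pos.le,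
    toReal_ofReal_mul_add Q.p_nonneg Q.q_nonneg (hfin _) (hfin _)]
  exact ENNReal.add_ne_top.mpr ⟨ENNReal.mul_ne_top ENNReal.ofReal_ne_top (hfin _),
    ENNReal.mul_ne_top ENNReal.ofReal_ne_top (hfin _)⟩

lemma chainProb_ne_top (goal : S → Prop) (x : S) : Q.chainProb step goal x ≠ ⊤ :=
  measure_ne_top _ _

end Chain

/-! ### Class `A` -/

lemma expTimeA_eq_chainTime (n : ℕ) :
    Q.expTimeA n = Q.chainTime stepA (fun x => x ≠ none) (some n) := by
  simp only [expTimeA, chainTime, pathA_eq_chainPath]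

lemma q_div_mu : Q.q / Q.mu = Q.meanGap := by
  have := Q.mu_pos.ne'
  have := Q.rate_pos.ne'
  rw [q, meanGap]
  field_simp

/-- Serves to make the times finite, so that the first-step equation can be solved in `ℝ`. -/
lemma chainTime_stepA_le (x : Option ℕ) : Q.chainTime stepA (fun x => x ≠ none) x
    ≤ ENNReal.ofReal (x.elim 0 fun n => (n + 1) / Q.mu) := by
  have hmu := Q.mu_pos
  refine Q.chainTime_le_ofReal stepA _ (u := fun x : Option ℕ => x.elim 0 fun n => (n + 1) / Q.mu)
    (fun x => ?_) (fun x => ?_) x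
  · cases x with
    | none => exact le_rfl
    | some n => simp only [Option.elim]; positivity
  · have hq := Q.q_div_mu
    have hp : Q.p = 1 - Q.q := by linarith [Q.p_add_q]
    match x with
    | none => simp [stepA, nextA]
    | some 0 =>
      simp only [stepA, nextA, ne_eq, reduceCtorEq, not_false_eq_true, if_true, if_false,
        Option.elim, Nat.cast_zero]
      rw [← hq, hp]
      apply le_of_eq
      ring
    | some (n + 1) =>
      simp only [stepA, nextA, ne_eq, reduceCtorEq, not_false_eq_true, if_true, if_false,
        Option.elim, Nat.cast_add, Nat.cast_one]
      rw [← hq, hp]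
      apply le_of_eq
      ring

lemma expTimeA_eq (n : ℕ) : Q.expTimeA n = ENNReal.ofReal ((n + 1) / Q.mu) := by
  have hmu := Q.mu_pos
  have hfin : ∀ x, Q.chainTime stepA (fun x => x ≠ none) x ≠ ⊤ := fun x =>
    ne_top_of_le_ne_top ENNReal.ofReal_ne_top (Q.chainTime_stepA_le x)
  have hp : Q.p = 1 - Q.q := by linarith [Q.p_add_q]
  have hq : 0 < Q.q := div_pos hmu Q.rate_pos
  rw [expTimeA_eq_chainTime, ← ENNReal.ofReal_toReal (hfin (some n))]
  congr 1
  -- An arrival leaves the state unchanged, so its term moves to the left side and a factor `q`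
  -- cancels: each service costs `1 / mu`.
  have key : ∀ x : Option ℕ, x ≠ none → (Q.chainTime stepA (fun x => x ≠ none) x).toReal
      = (Q.chainTime stepA (fun x => x ≠ none) (nextA x)).toReal + 1 / Q.mu := fun x hx => by
    have h := Q.toReal_chainTime stepA (fun x => x ≠ none) hfin hx
    simp only [stepA, if_true, if_false] at h
    rw [hp, ← Q.q_div_mu] at h
    apply mul_left_cancel₀ hq.ne'
    linear_combination h
  induction n with
  | zero =>
    rw [key _ (by simp), nextA, Q.chainTime_eq_zero stepA _ (by simp) (by simp [stepA])
      (by simp [stepA, nextA])]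
    simp
  | succ n ih =>
    rw [key _ (by simp), nextA, ih]
    push_cast
    ring

lemma payoffA_nonneg_iff (n : ℕ) : 0 ≤ Q.payoffA n ↔ n < Q.MA := by
  have hmu := Q.mu_pos
  have hC := Q.CA_pos
  have e : Q.payoffA n = ((Q.RA - Q.CA * ((n + 1) / Q.mu) : ℝ) : EReal) := by
    rw [payoffA, expTimeA_eq, ← ENNReal.ofReal_mul hC.le, EReal.coe_ennreal_ofReal,
      max_eq_left (by positivity), EReal.coe_sub]
  rw [e, EReal.coe_nonneg, MA, ← Nat.succ_le_iff, Nat.le_floor_iff (by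
    have : 0 ≤ Q.RA * Q.mu := hC.le.trans Q.rewardA
    positivity), le_div_iff₀ hC, sub_nonneg, ← mul_div_assoc, div_le_iff₀ hmu]
  push_cast
  rw [mul_comm]

/-! ### Class `B` -/

/-- Naor's strategy for the `A`-customers. -/
abbrev naor : StrategyA := fun n => n < Q.MA

/-- Expected time that it takes to be relieved of one of the customers ahead, when `m` more
`A`-customers would be admitted. -/
noncomputable def tau : ℕ → ℝ
  | 0 => 1 / Q.mu
  | m + 1 => (1 + Q.lamA * tau m) / Q.mu

lemma tau_pos (m : ℕ) : 0 < Q.tau m := by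
  have := Q.mu_pos
  have := Q.lamA_pos
  induction m with
  | zero => rw [tau]; positivity
  | succ m ih => rw [tau]; positivity

lemma mu_mul_tau_zero : Q.mu * Q.tau 0 = 1 := by
  rw [tau, mul_one_div_cancel Q.mu_pos.ne']

lemma mu_mul_tau_succ (m : ℕ) : Q.mu * Q.tau (m + 1) = 1 + Q.lamA * Q.tau m := by
  rw [tau, mul_div_cancel₀ _ Q.mu_pos.ne']

/-- Expected time in the system of a `B`-customer behind `i` `A`-customers and `j` `B`-customers when
nobody reneges. -/
noncomputable def stayTime (i j : ℕ) : ℝ :=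
  ∑ k ∈ Finset.range i, Q.tau (Q.MA - (k + 1)) + (j + 1) * Q.tau Q.MA

lemma stayTime_pos (i j : ℕ) : 0 < Q.stayTime i j :=
  add_pos_of_nonneg_of_pos (Finset.sum_nonneg fun _ _ => (Q.tau_pos _).le)
    (mul_pos (by positivity) (Q.tau_pos _))

lemma stayTime_mono {i j j' : ℕ} (h : j ≤ j') : Q.stayTime i j ≤ Q.stayTime i j' := by
  have : (j : ℝ) ≤ j' := by exact_mod_cast h
  have := Q.tau_pos Q.MA
  unfold stayTime
  gcongr

lemma stayTime_succ_left (i j : ℕ) :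
    Q.stayTime (i + 1) j = Q.stayTime i j + Q.tau (Q.MA - (i + 1)) := by
  rw [stayTime, Finset.sum_range_succ, stayTime]
  ring

lemma stayTime_zero_succ (j : ℕ) : Q.stayTime 0 (j + 1) = Q.stayTime 0 j + Q.tau Q.MA := by
  simp only [stayTime]
  push_cast
  ring

lemma stayTime_zero_zero : Q.stayTime 0 0 = Q.tau Q.MA := by
  simp [stayTime]

/-- The equation for a cost rate `c` up to the next event, and the value `x` after an arrival or `y`
after a service completion, in terms of the rates of these events. -/
lemma eq_mean_iff {c x y z : ℝ} : z = Q.meanGap * c + (Q.p * x + Q.q * y) ↔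
    (Q.lamA + Q.mu) * z = c + Q.lamA * x + Q.mu * y := by
  have := Q.rate_pos.ne'
  rw [meanGap, p, q]
  field_simp
  constructor <;> intro h <;> linear_combination h

lemma stayTime_join {i j : ℕ} {y : ℝ} (hi : i < Q.MA)
    (hy : Q.stayTime i j = y + Q.tau (Q.MA - i)) :
    Q.stayTime i j = Q.meanGap + (Q.p * Q.stayTime (i + 1) j + Q.q * y) := by
  rw [← mul_one Q.meanGap, eq_mean_iff, stayTime_succ_left]
  have h := Q.mu_mul_tau_succ (Q.MA - (i + 1))
  rw [show Q.MA - (i + 1) + 1 = Q.MA - i by omega] at h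
  linear_combination Q.mu * hy + h

lemma stayTime_balk {i j : ℕ} {y : ℝ} (hi : ¬ i < Q.MA)
    (hy : Q.stayTime i j = y + Q.tau (Q.MA - i)) :
    Q.stayTime i j = Q.meanGap + (Q.p * Q.stayTime i j + Q.q * y) := by
  rw [← mul_one Q.meanGap, eq_mean_iff]
  -- Truncated subtraction gives the right room, zero, also when `i > MA`; the equation thus holds
  -- in all states, not only in those that can arise.
  rw [Nat.sub_eq_zero_of_le (by omega)] at hy
  linear_combination Q.mu * hy + Q.mu_mul_tau_zero

/-- Time in the system of a `B`-customer of given status, when nobody reneges. -/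
noncomputable def stayTimeOf : StatusB → ℝ
  | .present i j => Q.stayTime i j
  | .served => 0
  | .gone => 0

lemma stayTimeOf_nonneg (x : StatusB) : 0 ≤ Q.stayTimeOf x := by
  cases x with
  | present i j => exact (Q.stayTime_pos i j).le
  | served => exact le_rfl
  | gone => exact le_rfl

lemma stayTimeOf_review_le (s t : StrategyB) (i j : ℕ) :
    Q.stayTimeOf (review s t i j) ≤ Q.stayTime i j := by
  rw [review]
  split_ifs
  · exact Q.stayTime_mono (remaining_le s i j)
  · exact (Q.stayTime_pos i j).le

lemma exists_service (s t : StrategyB) (i j : ℕ) :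
    ∃ y, Q.stayTime i j = y + Q.tau (Q.MA - i) ∧
      Q.stayTimeOf (stepB Q.naor s t False (.present i j)) ≤ y := by
  match i, j with
  | i + 1, j =>
    rw [stepB_false_succ]
    exact ⟨_, Q.stayTime_succ_left i j, Q.stayTimeOf_review_le s t i j⟩
  | 0, j + 1 =>
    rw [stepB_false_zero_succ]
    exact ⟨_, Q.stayTime_zero_succ j, Q.stayTimeOf_review_le s t 0 j⟩
  | 0, 0 =>
    rw [stepB_false_zero_zero]
    exact ⟨0, by simp [stayTime_zero_zero], le_rfl⟩

/-- Without reneging this is an equality; reneging, by her or by those ahead, only shortens the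
time. Valid for all strategies, it yields finiteness of `timeB` and the strict perturbation in
`nonneg_of_supermean`. -/
lemma stayTimeOf_supermean (s t : StrategyB) {x : StatusB} (hx : x.IsPresent) :
    Q.meanGap + (Q.p * Q.stayTimeOf (stepB Q.naor s t True x)
      + Q.q * Q.stayTimeOf (stepB Q.naor s t False x)) ≤ Q.stayTimeOf x := by
  obtain ⟨i, j, rfl⟩ := hx
  obtain ⟨y, hy, hle⟩ := Q.exists_service s t i j
  have hp := Q.p_nonneg
  have hq := Q.q_nonneg
  by_cases hi : i < Q.MA
  · rw [stepB_true_of_join Q.naor _ _ hi]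
    refine le_of_le_of_eq ?_ (Q.stayTime_join hi hy).symm
    gcongr
    exact Q.stayTimeOf_review_le ..
  · rw [stepB_true_of_balk Q.naor _ _ hi]
    refine le_of_le_of_eq ?_ (Q.stayTime_balk hi hy).symm
    gcongr
    exact Q.stayTimeOf_review_le ..

/-- Expected time in the system of a `B`-customer when the `A`-customers use Naor's strategy. -/
noncomputable def timeB (s t : StrategyB) (x : StatusB) : ℝ≥0∞ :=
  Q.chainTime (stepB Q.naor s t) StatusB.IsPresent x

lemma expTimeB_eq (s t : StrategyB) (x : StatusB) :
    Q.expTimeB Q.naor s t x = Q.timeB s t x := by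
  simp only [expTimeB, timeB, chainTime, pathB_eq_chainPath]
  rfl

lemma timeB_ne_top (s t : StrategyB) (x : StatusB) : Q.timeB s t x ≠ ⊤ := by
  refine ne_top_of_le_ne_top ENNReal.ofReal_ne_top
    (Q.chainTime_le_ofReal _ _ Q.stayTimeOf_nonneg (fun x => ?_) x)
  cases x with
  | present i j =>
    rw [if_pos (StatusB.isPresent_present i j)]
    exact Q.stayTimeOf_supermean s t (StatusB.isPresent_present i j)
  | served => simp [StatusB.not_isPresent_served, stepB_served, stayTimeOf]
  | gone => simp [StatusB.not_isPresent_gone, stepB_gone, stayTimeOf]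

/-- Probability of being served, when the `A`-customers use Naor's strategy. -/
noncomputable def servedB (s t : StrategyB) (x : StatusB) : ℝ≥0∞ :=
  Q.chainProb (stepB Q.naor s t) (fun y => y = StatusB.served) x

lemma probB_eq (s t : StrategyB) (x : StatusB) :
    Q.probB Q.naor s t x = Q.servedB s t x := by
  simp only [probB, servedB, chainProb, pathB_eq_chainPath]

/-- Expected payoff of a `B`-customer with reward `R` and unit cost `C`, when the `A`-customers use
Naor's strategy. -/
noncomputable def pay (R C : ℝ) (s t : StrategyB) (x : StatusB) : ℝ :=
  R * (Q.servedB s t x).toReal - C * (Q.timeB s t x).toReal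

lemma RB_pos : 0 < Q.RB := by
  have h : 0 < Q.RB * Q.mu := Q.CB_pos.trans_le Q.rewardB
  exact pos_of_mul_pos_left h Q.mu_pos.le

lemma payoffB_eq (s t : StrategyB) (x : StatusB) :
    Q.payoffB Q.naor s t x = (Q.pay Q.RB Q.CB s t x : EReal) := by
  rw [payoffB, probB_eq, expTimeB_eq, pay, EReal.coe_sub]
  have hp : Q.servedB s t x ≠ ⊤ := Q.chainProb_ne_top _ _ _
  congr 1
  · rw [← ENNReal.ofReal_toReal hp,
      ← ENNReal.ofReal_mul Q.RB_pos.le, EReal.coe_ennreal_ofReal, ENNReal.toReal_ofReal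
      ENNReal.toReal_nonneg, max_eq_left (mul_nonneg Q.RB_pos.le ENNReal.toReal_nonneg)]
  · rw [← ENNReal.ofReal_toReal (Q.timeB_ne_top s t x),
      ← ENNReal.ofReal_mul Q.CB_pos.le, EReal.coe_ennreal_ofReal, ENNReal.toReal_ofReal
      ENNReal.toReal_nonneg, max_eq_left (mul_nonneg Q.CB_pos.le ENNReal.toReal_nonneg)]

section Pay

variable (R C : ℝ) (s t : StrategyB)

lemma pay_served : Q.pay R C s t .served = R := by
  have h : Q.servedB s t .served = 1 := Q.chainProb_eq_one _ rfl
  rw [pay, h, timeB, chainTime_eq_zero _ _ _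
    StatusB.not_isPresent_served (stepB_served ..) (stepB_served ..)]
  simp

lemma pay_gone : Q.pay R C s t .gone = 0 := by
  rw [pay, servedB, timeB, chainProb_eq_zero _ _ (by simp) (stepB_gone ..) (stepB_gone ..),
    chainTime_eq_zero _ _ _ StatusB.not_isPresent_gone (stepB_gone ..) (stepB_gone ..)]
  simp

lemma pay_present (i j : ℕ) : Q.pay R C s t (.present i j) =
    Q.meanGap * (-C) + (Q.p * Q.pay R C s t (stepB Q.naor s t True (.present i j))
      + Q.q * Q.pay R C s t (stepB Q.naor s t False (.present i j))) := by
  have h1 := Q.toReal_chainTime (stepB Q.naor s t) _ (Q.timeB_ne_top s t)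
    (StatusB.isPresent_present i j)
  have h2 := congrArg ENNReal.toReal (Q.chainProb_eq (stepB Q.naor s t)
    (goal := fun y => y = .served) (x := .present i j) (by simp))
  rw [toReal_ofReal_mul_add Q.p_nonneg Q.q_nonneg (Q.chainProb_ne_top _ _ _)
    (Q.chainProb_ne_top _ _ _)] at h2
  simp only [pay, timeB, servedB]
  rw [h1, h2]
  ring

end Pay

/-! ### Minimum principle and verification of payoffs. -/

lemma exists_neg_le_of_box (d : StatusB → ℝ) (G : StatusB → Prop) {I J : ℕ}
    (hbox : ∀ i j, G (.present i j) → i ≤ I ∧ j ≤ J) : ∃ K, ∀ x, G x → -K ≤ d x := by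
  have hfin : {x | G x}.Finite := by
    refine Set.Finite.subset ((((Finset.range (I + 1) ×ˢ Finset.range (J + 1)).finite_toSet.image
      fun y => StatusB.present y.1 y.2).insert .served).insert .gone) fun x hx => ?_
    cases x with
    | present i j =>
      obtain ⟨h1, h2⟩ := hbox i j hx
      refine Or.inr (Or.inr ⟨(i, j), ?_, rfl⟩)
      simp only [Finset.coe_product, Finset.coe_range, Set.mem_prod, Set.mem_Iio]
      omega
    | served => exact Or.inr (Or.inl rfl)
    | gone => exact Or.inl rfl
  obtain ⟨K, hK⟩ := (hfin.image d).bddBelow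
  exact ⟨-K, fun x hx => by simpa using hK ⟨x, hx, rfl⟩⟩

/-- Adding `ε * stayTimeOf` makes the supermean inequality strict while the customer is present; the
strict case applies, and `ε` tends to `0`. The box leaves finitely many states, hence a lower bound
for `d`. -/
lemma nonneg_of_supermean (s t : StrategyB) (d : StatusB → ℝ) (G : StatusB → Prop) {I J : ℕ}
    (hbox : ∀ i j, G (.present i j) → i ≤ I ∧ j ≤ J)
    (hG : ∀ x, G x → G (stepB Q.naor s t True x) ∧ G (stepB Q.naor s t False x))
    (h1 : 0 ≤ d .served) (h0 : 0 ≤ d .gone)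
    (hd : ∀ i j, G (.present i j) → Q.p * d (stepB Q.naor s t True (.present i j))
      + Q.q * d (stepB Q.naor s t False (.present i j)) ≤ d (.present i j))
    {x : StatusB} (hx : G x) : 0 ≤ d x := by
  obtain ⟨K, hK⟩ := exists_neg_le_of_box d G hbox
  have key : ∀ ε > 0, 0 ≤ d x + ε * Q.stayTimeOf x := by
    intro ε hε
    refine nonneg_of_strict_supermean (stepB Q.naor s t True) (stepB Q.naor s t False) Q.p_nonneg
      Q.q_nonneg Q.p_add_q (mul_pos hε Q.meanGap_pos) StatusB.IsPresent G hG (K := K)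
      (v := fun x => d x + ε * Q.stayTimeOf x) (fun x hx => ?_) (fun x _ hx => ?_)
      (fun x hx hl => ?_) hx
    · have := mul_nonneg hε.le (Q.stayTimeOf_nonneg x)
      linarith [hK x hx]
    · cases x with
      | present i j => exact absurd (StatusB.isPresent_present i j) hx
      | served => simpa [stayTimeOf] using h1
      | gone => simpa [stayTimeOf] using h0
    · have e := mul_le_mul_of_nonneg_left (Q.stayTimeOf_supermean s t hl) hε.le
      obtain ⟨i, j, rfl⟩ := hl
      linarith [hd i j hx]
  by_contra hneg
  push Not at hneg
  have hu := Q.stayTimeOf_nonneg x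
  -- With this `ε` the perturbation is at most `-d x / 2`, too small to compensate a negative `d x`.
  have := key (-d x / (2 * (Q.stayTimeOf x + 1))) (by apply div_pos <;> linarith)
  have e : -d x / (2 * (Q.stayTimeOf x + 1)) * Q.stayTimeOf x ≤ -d x / 2 := by
    rw [div_mul_eq_mul_div, div_le_div_iff₀ (by positivity) (by positivity)]
    nlinarith
  linarith

lemma pay_le_of_supermean {R C : ℝ} {s t : StrategyB} {w : StatusB → ℝ} (G : StatusB → Prop)
    {I J : ℕ} (hbox : ∀ i j, G (.present i j) → i ≤ I ∧ j ≤ J)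
    (hG : ∀ x, G x → G (stepB Q.naor s t True x) ∧ G (stepB Q.naor s t False x))
    (h1 : R ≤ w .served) (h0 : 0 ≤ w .gone)
    (hw : ∀ i j, G (.present i j) →
      Q.meanGap * (-C) + (Q.p * w (stepB Q.naor s t True (.present i j))
        + Q.q * w (stepB Q.naor s t False (.present i j))) ≤ w (.present i j))
    {x : StatusB} (hx : G x) : Q.pay R C s t x ≤ w x := by
  refine sub_nonneg.mp (Q.nonneg_of_supermean s t (fun x => w x - Q.pay R C s t x) G hbox hG
    (by simpa [pay_served] using h1) (by simpa [pay_gone] using h0) (fun i j hij => ?_) hx)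
  rw [Q.pay_present R C s t i j]
  linarith [hw i j hij]

lemma pay_eq_of_mean {R C : ℝ} {s t : StrategyB} {w : StatusB → ℝ} (G : StatusB → Prop)
    {I J : ℕ} (hbox : ∀ i j, G (.present i j) → i ≤ I ∧ j ≤ J)
    (hG : ∀ x, G x → G (stepB Q.naor s t True x) ∧ G (stepB Q.naor s t False x))
    (h1 : w .served = R) (h0 : w .gone = 0)
    (hw : ∀ i j, G (.present i j) →
      w (.present i j) = Q.meanGap * (-C) + (Q.p * w (stepB Q.naor s t True (.present i j))
        + Q.q * w (stepB Q.naor s t False (.present i j))))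
    {x : StatusB} (hx : G x) : Q.pay R C s t x = w x := by
  refine le_antisymm (Q.pay_le_of_supermean G hbox hG h1.ge h0.ge
    (fun i j hij => (hw i j hij).ge) hx) ?_
  refine sub_nonneg.mp (Q.nonneg_of_supermean s t (fun x => Q.pay R C s t x - w x) G hbox hG
    (by simp [pay_served, h1]) (by simp [pay_gone, h0]) (fun i j hij => ?_) hx)
  rw [Q.pay_present R C s t i j]
  linarith [hw i j hij]

lemma stepB_present {i : ℕ} (hi : i ≤ Q.MA) (j : ℕ) (e : Prop) :
    (∀ s t, stepB Q.naor s t e (.present i j) = .served) ∨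
      ∃ i' ≤ Q.MA, ∃ j' ≤ j, ∀ s t, stepB Q.naor s t e (.present i j) = review s t i' j' := by
  by_cases he : e
  · rw [eq_true he]
    by_cases h : i < Q.MA
    · exact Or.inr ⟨i + 1, h, j, le_rfl, fun s t => stepB_true_of_join Q.naor s t h j⟩
    · exact Or.inr ⟨i, hi, j, le_rfl, fun s t => stepB_true_of_balk Q.naor s t h j⟩
  · rw [eq_false he]
    match i, j with
    | i + 1, j => exact Or.inr ⟨i, by omega, j, le_rfl, fun s t => stepB_false_succ Q.naor s t i j⟩
    | 0, j + 1 =>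
      exact Or.inr ⟨0, by omega, j, by omega, fun s t => stepB_false_zero_succ Q.naor s t j⟩
    | 0, 0 => exact Or.inl fun s t => stepB_false_zero_zero Q.naor s t

lemma stayTime_mono_left {i i' : ℕ} (h : i ≤ i') (j : ℕ) : Q.stayTime i j ≤ Q.stayTime i' j := by
  induction h with
  | refl => exact le_rfl
  | step _ ih => rw [Nat.succ_eq_add_one, stayTime_succ_left]; linarith [Q.tau_pos (Q.MA - (‹ℕ› + 1))]

lemma stayTime_succ_right (i j : ℕ) : Q.stayTime i (j + 1) = Q.stayTime i j + Q.tau Q.MA := by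
  simp only [stayTime]
  push_cast
  ring

lemma stayTime_MA (j : ℕ) : Q.stayTime Q.MA j
    = ∑ m ∈ Finset.range Q.MA, Q.tau m + (j + 1) * Q.tau Q.MA := by
  rw [stayTime, ← Finset.sum_range_reflect Q.tau]
  congr 1
  exact Finset.sum_congr rfl fun k _ => by rw [Nat.sub_sub, add_comm 1]

/-! ### The value function of the threshold strategy. -/

/-- Payoff of a `B`-customer who stays forever when the state on joining is `(MA, v)`. -/
noncomputable def surplus (v : ℕ) : ℝ := Q.RB - Q.CB * Q.stayTime Q.MA v

/-- Value of a position ahead of which `k` more customers would be tolerated, when more than `v`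
`B`-customers are ahead. -/
noncomputable def rearValue (v k : ℕ) : ℝ :=
  Q.surplus v * Q.tau k / Q.tau Q.MA + Q.CB * ∑ m ∈ Finset.range k, Q.tau m

/-- Value of the status of a `B`-customer when the `B`-customers stay in front of position
`MA + v + 1`. -/
noncomputable def value (v : ℕ) : StatusB → ℝ
  | .present i j =>
      if j ≤ v then Q.RB - Q.CB * Q.stayTime i j
      else if i + j < Q.MA + v + 1 then Q.rearValue v (Q.MA + v - (i + j)) else 0
  | .served => Q.RB
  | .gone => 0

/-- The `B`-customers stay exactly in front of position `MA + v + 1`, as long as the number of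
`A`-customers does not exceed `MA`. -/
def IsThreshold (v : ℕ) (s : StrategyB) : Prop :=
  ∀ i j, i ≤ Q.MA → (s i j ↔ i + j < Q.MA + v + 1)

variable {Q} {v : ℕ} {s : StrategyB}

lemma value_front {i j : ℕ} (hj : j ≤ v) :
    Q.value v (.present i j) = Q.RB - Q.CB * Q.stayTime i j := if_pos hj

lemma value_rear {i j k : ℕ} (hj : v < j) (hk : i + j + k = Q.MA + v) :
    Q.value v (.present i j) = Q.rearValue v k := by
  rw [value, if_neg (by omega), if_pos (by omega)]
  congr 1
  omega

lemma value_of_threshold_le {i j : ℕ} (hj : v < j) (h : Q.MA + v + 1 ≤ i + j) :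
    Q.value v (.present i j) = 0 := by
  rw [value, if_neg (by omega), if_neg (by omega)]

/-- Matching at the boundary: slack `MA` with more than `v` `B`-customers in the formula continues
into the front state `(0, v)`. This fixes the coefficient of `tau k` in `rearValue`. -/
lemma rearValue_MA : Q.rearValue v Q.MA = Q.RB - Q.CB * Q.stayTime 0 v := by
  have := (Q.tau_pos Q.MA).ne'
  rw [rearValue, surplus, mul_div_assoc, div_self this, stayTime_MA, stayTime]
  simp only [Finset.range_zero, Finset.sum_empty]
  ring

lemma rearValue_nonneg (h0 : 0 ≤ Q.surplus v) (k : ℕ) : 0 ≤ Q.rearValue v k :=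
  add_nonneg (div_nonneg (mul_nonneg h0 (Q.tau_pos k).le) (Q.tau_pos _).le)
    (mul_nonneg Q.CB_pos.le (Finset.sum_nonneg fun m _ => (Q.tau_pos m).le))

lemma value_nonneg (h0 : 0 ≤ Q.surplus v) {i : ℕ} (hi : i ≤ Q.MA) (j : ℕ) :
    0 ≤ Q.value v (.present i j) := by
  rw [value]
  split_ifs with h1 h2
  · refine h0.trans ?_
    rw [surplus]
    have := (Q.stayTime_mono_left hi j).trans (Q.stayTime_mono (i := Q.MA) h1)
    have := mul_le_mul_of_nonneg_left this Q.CB_pos.le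
    linarith
  · exact rearValue_nonneg h0 _
  · exact le_rfl

/-- `tau` solves the homogeneous recurrence, and `CB` times its partial sums absorbs the waiting
cost. -/
lemma rearValue_succ_mean (k : ℕ) : (Q.lamA + Q.mu) * Q.rearValue v (k + 1)
    = -Q.CB + Q.lamA * Q.rearValue v k + Q.mu * Q.rearValue v (k + 1 + 1) := by
  have h1 := Q.mu_mul_tau_succ k
  have h2 := Q.mu_mul_tau_succ (k + 1)
  simp only [rearValue, Finset.sum_range_succ, div_eq_mul_inv]
  linear_combination (Q.surplus v * (Q.tau Q.MA)⁻¹ - Q.CB) * h1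
    - Q.surplus v * (Q.tau Q.MA)⁻¹ * h2

/-- The same recurrence at slack `0`, where an arrival leads to leaving with value `0`. -/
lemma rearValue_zero_mean : (Q.lamA + Q.mu) * Q.rearValue v 0
    = -Q.CB + Q.mu * Q.rearValue v 1 := by
  have h1 := Q.mu_mul_tau_zero
  have h2 := Q.mu_mul_tau_succ 0
  simp only [zero_add] at h2
  simp only [rearValue, Finset.sum_range_succ, Finset.sum_range_zero, div_eq_mul_inv]
  linear_combination (Q.surplus v * (Q.tau Q.MA)⁻¹ - Q.CB) * h1
    - Q.surplus v * (Q.tau Q.MA)⁻¹ * h2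

lemma mu_mul_rearValue_zero_lt (h1 : Q.surplus (v + 1) < 0) : Q.mu * Q.rearValue v 0 < Q.CB := by
  have e : Q.mu * Q.rearValue v 0 = Q.surplus v / Q.tau Q.MA := by
    rw [rearValue, Finset.sum_range_zero]
    linear_combination (Q.surplus v / Q.tau Q.MA) * Q.mu_mul_tau_zero
  rw [e, div_lt_iff₀ (Q.tau_pos _)]
  rw [surplus, stayTime_succ_right] at h1
  rw [surplus]
  linarith

lemma remaining_threshold (hs : Q.IsThreshold v s) {i : ℕ} (hi : i ≤ Q.MA) (j : ℕ) :
    remaining s i j = min j (Q.MA + v + 1 - i) := by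
  induction j with
  | zero => simp [remaining]
  | succ j ih =>
    rw [remaining, ih]
    split_ifs with h
    · rw [hs i _ hi] at h
      omega
    · rw [hs i _ hi] at h
      omega

lemma review_threshold_of_lt (hs : Q.IsThreshold v s) {i j : ℕ} (hi : i ≤ Q.MA) (h : i + j < Q.MA + v + 1) :
    review s s i j = .present i j := by
  have e : remaining s i j = j := by rw [remaining_threshold hs hi]; omega
  rw [review, e, if_pos ((hs i j hi).mpr h)]

lemma review_threshold_of_le (hs : Q.IsThreshold v s) {i j : ℕ} (hi : i ≤ Q.MA) (h : Q.MA + v + 1 ≤ i + j) :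
    review s s i j = .gone := by
  rw [review, if_neg]
  rw [remaining_threshold hs hi, hs _ _ hi]
  omega

/-- Reneging occurs only where `value` is already `0`, so the review can be ignored when computing
values. -/
lemma value_review_self (hs : Q.IsThreshold v s) {i : ℕ} (hi : i ≤ Q.MA) (j : ℕ) :
    Q.value v (review s s i j) = Q.value v (.present i (remaining s i j)) := by
  rcases lt_or_ge (i + j) (Q.MA + v + 1) with h | h
  · rw [review_threshold_of_lt hs hi h, remaining_threshold hs hi]
    congr 2
    omega
  · rw [review_threshold_of_le hs hi h, remaining_threshold hs hi,
      value_of_threshold_le (by omega) (by omega)]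
    rfl

lemma value_review_le (hs : Q.IsThreshold v s) (h0 : 0 ≤ Q.surplus v) (t : StrategyB) {i : ℕ} (hi : i ≤ Q.MA) (j : ℕ) :
    Q.value v (review s t i j) ≤ Q.value v (review s s i j) := by
  rw [value_review_self hs hi, review]
  split_ifs
  · exact le_rfl
  · exact value_nonneg h0 hi _

lemma value_stepB_le (hs : Q.IsThreshold v s) (h0 : 0 ≤ Q.surplus v) (t : StrategyB) {i : ℕ} (hi : i ≤ Q.MA) (j : ℕ)
    (e : Prop) : Q.value v (stepB Q.naor s t e (.present i j))
      ≤ Q.value v (stepB Q.naor s s e (.present i j)) := by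
  rcases Q.stepB_present hi j e with h | ⟨i', hi', j', -, h⟩
  · rw [h, h]
  · rw [h, h]
    exact value_review_le hs h0 t hi' j'

lemma value_service_front (hs : Q.IsThreshold v s) {i j : ℕ} (hi : i ≤ Q.MA) (hj : j ≤ v) :
    ∃ y, Q.stayTime i j = y + Q.tau (Q.MA - i) ∧
      Q.value v (stepB Q.naor s s False (.present i j)) = Q.RB - Q.CB * y := by
  match i, j with
  | i + 1, j =>
    refine ⟨_, Q.stayTime_succ_left i j, ?_⟩
    rw [stepB_false_succ, review_threshold_of_lt hs (by omega) (by omega), value_front hj]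
  | 0, j + 1 =>
    refine ⟨_, Q.stayTime_zero_succ j, ?_⟩
    rw [stepB_false_zero_succ, review_threshold_of_lt hs (by omega) (by omega),
      value_front (by omega)]
  | 0, 0 =>
    refine ⟨0, by simp [stayTime_zero_zero], ?_⟩
    rw [stepB_false_zero_zero, value]
    ring

lemma value_service_rear (hs : Q.IsThreshold v s) {i j k : ℕ} (hi : i ≤ Q.MA) (hj : v < j)
    (hk : i + j + k = Q.MA + v + 1) :
    Q.value v (stepB Q.naor s s False (.present i j)) = Q.rearValue v k := by
  match i, j with
  | i + 1, j =>
    rw [stepB_false_succ, review_threshold_of_lt hs (by omega) (by omega),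
      value_rear (k := k) hj (by omega)]
  | 0, j + 1 =>
    rw [stepB_false_zero_succ, review_threshold_of_lt hs (by omega) (by omega)]
    rcases Nat.lt_or_ge v j with h | h
    -- Otherwise the service brings her to the front state `(0, v)`, where the two formulas for the
    -- value meet.
    · exact value_rear h (by omega)
    · obtain rfl : j = v := by omega
      obtain rfl : k = Q.MA := by omega
      rw [value_front le_rfl, rearValue_MA]

lemma value_mean (hs : Q.IsThreshold v s) {i j : ℕ} (hi : i ≤ Q.MA) (h : i + j < Q.MA + v + 1) :
    Q.value v (.present i j) = Q.meanGap * (-Q.CB)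
      + (Q.p * Q.value v (stepB Q.naor s s True (.present i j))
        + Q.q * Q.value v (stepB Q.naor s s False (.present i j))) := by
  rcases Nat.lt_or_ge v j with hj | hj
  -- Behind the front and below the threshold, every arriving `A`-customer is admitted, so each
  -- arrival really uses up one unit of slack.
  · have him : i < Q.MA := by omega
    obtain ⟨k, hk⟩ : ∃ k, i + j + k = Q.MA + v := ⟨Q.MA + v - (i + j), by omega⟩
    rw [value_service_rear hs (k := k + 1) hi hj (by omega), value_rear hj hk,
      stepB_true_of_join Q.naor _ _ him, value_review_self hs him, remaining_threshold hs him,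
      min_eq_left (by omega), eq_mean_iff]
    cases k with
    | zero =>
      rw [value_of_threshold_le hj (by omega), rearValue_zero_mean]
      ring
    | succ k => rw [value_rear (k := k) hj (by omega), rearValue_succ_mean]
  · obtain ⟨y, hy, he⟩ := value_service_front hs hi hj
    rw [he, value_front hj]
    have hpq := Q.p_add_q
    by_cases him : i < Q.MA
    · rw [stepB_true_of_join Q.naor _ _ him, review_threshold_of_lt hs him (by omega),
        value_front hj]
      linear_combination (-Q.CB) * Q.stayTime_join him hy - Q.RB * hpq
    · rw [stepB_true_of_balk Q.naor _ _ him, review_threshold_of_lt hs hi h, value_front hj]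
      linear_combination (-Q.CB) * Q.stayTime_balk him hy - Q.RB * hpq

lemma value_threshold_mean_neg (hs : Q.IsThreshold v s) (h1 : Q.surplus (v + 1) < 0) {i j : ℕ} (hi : i ≤ Q.MA)
    (h : i + j = Q.MA + v + 1) :
    Q.meanGap * (-Q.CB) + (Q.p * Q.value v (stepB Q.naor s s True (.present i j))
        + Q.q * Q.value v (stepB Q.naor s s False (.present i j))) < 0 := by
  have hj : v < j := by omega
  have hT : Q.value v (stepB Q.naor s s True (.present i j)) = 0 := by
    by_cases him : i < Q.MA
    · rw [stepB_true_of_join Q.naor _ _ him, review_threshold_of_le hs him (by omega)]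
      rfl
    · rw [stepB_true_of_balk Q.naor _ _ him, review_threshold_of_le hs hi (by omega)]
      rfl
  rw [hT, value_service_rear hs (k := 0) hi hj (by omega)]
  have hl := mu_mul_rearValue_zero_lt h1
  have e : Q.meanGap * (-Q.CB) + (Q.p * 0 + Q.q * Q.rearValue v 0)
      = Q.meanGap * (Q.mu * Q.rearValue v 0 - Q.CB) := by
    rw [meanGap, q]
    ring
  rw [e]
  exact mul_neg_of_pos_of_neg Q.meanGap_pos (by linarith)

end Params

/-! ### Uniqueness of the equilibrium. -/

lemma chainPath_congr {S : Type*} {step step' : Prop → S → S} (G : S → Prop)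
    (hG : ∀ e x, G x → G (step e x)) (h : ∀ e x, G x → step e x = step' e x) {x : S} (hx : G x)
    (ω : Clocks) (k : ℕ) : chainPath step x ω k = chainPath step' x ω k := by
  have : G (chainPath step x ω k) ∧ chainPath step x ω k = chainPath step' x ω k := by
    induction k with
    | zero => exact ⟨hx, rfl⟩
    | succ k ih =>
      refine ⟨hG _ _ ih.1, ?_⟩
      rw [chainPath, chainPath, ← ih.2]
      exact h _ _ ih.1
  exact this.2

lemma review_congr {s s' : StrategyB} {i j : ℕ} (h : ∀ k < j, (s i k ↔ s' i k)) (t : StrategyB) :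
    review s t i j = review s' t i j := by
  rw [review, review, remaining_congr h]

namespace Params

variable {Q : Params}

/-- The status satisfies `g` if the customer is in the system. -/
def WhilePresent (g : ℕ → ℕ → Prop) : StatusB → Prop
  | .present i j => g i j
  | .served => True
  | .gone => True

lemma whilePresent_review {g : ℕ → ℕ → Prop} {s t : StrategyB} {i j : ℕ}
    (h : t i (remaining s i j) → g i (remaining s i j)) : WhilePresent g (review s t i j) := by
  rw [review]
  split_ifs with ht
  · exact h ht
  · trivial

lemma whilePresent_stepB {g : ℕ → ℕ → Prop} (hgM : ∀ i j, g i j → i ≤ Q.MA) {s t : StrategyB}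
    (h : ∀ i j i' j', g i j → i' ≤ Q.MA → j' ≤ j → t i' (remaining s i' j') →
      g i' (remaining s i' j'))
    (e : Prop) {x : StatusB} (hx : WhilePresent g x) :
    WhilePresent g (stepB Q.naor s t e x) := by
  cases x with
  | present i j =>
    rcases Q.stepB_present (hgM i j hx) j e with hst | ⟨i', hi', j', hj', hst⟩
    · rw [hst]; trivial
    · rw [hst]
      exact whilePresent_review fun ht => h i j i' j' hx hi' hj' ht
  | served => rw [stepB_served]; trivial
  | gone => rw [stepB_gone]; trivial

/-- The number of `B`-customers ahead never increases, so only the others' decisions with fewer than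
`J` ahead can matter. -/
lemma pay_congr {s s' : StrategyB} {J : ℕ} (h : ∀ i k, i ≤ Q.MA → k < J → (s i k ↔ s' i k))
    (R C : ℝ) (t : StrategyB) {x : StatusB} (hx : WhilePresent (fun i j => i ≤ Q.MA ∧ j ≤ J) x) :
    Q.pay R C s t x = Q.pay R C s' t x := by
  have key : ∀ ω k, chainPath (stepB Q.naor s t) x ω k = chainPath (stepB Q.naor s' t) x ω k := by
    refine chainPath_congr _ (fun e y hy => whilePresent_stepB (fun i j h => h.1)
      (fun i j i' j' hij hi' hj' _ => ⟨hi', (remaining_le s i' j').trans (hj'.trans hij.2)⟩) e hy)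
      (fun e y hy => ?_) hx
    cases y with
    | present i j =>
      rcases Q.stepB_present hy.1 j e with hst | ⟨i', hi', j', hj', hst⟩
      · rw [hst, hst]
      · rw [hst, hst]
        exact review_congr (fun k hk => h i' k hi' (hk.trans_le (hj'.trans hy.2))) t
    | served => rw [stepB_served, stepB_served]
    | gone => rw [stepB_gone, stepB_gone]
  simp only [pay, servedB, timeB, chainProb, chainTime, key]

lemma forall_lt_naor_iff (i : ℕ) : (∀ k < i, Q.naor k) ↔ i ≤ Q.MA :=
  ⟨fun h => by by_contra hi; exact lt_irrefl _ (h Q.MA (by omega)), fun h _ hk => hk.trans_le h⟩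

lemma isEquilibrium_naor_iff (s : StrategyB) : Q.IsEquilibrium Q.naor s ↔
    (∀ i j, i ≤ Q.MA → (s i j ↔ 0 ≤ Q.pay Q.RB Q.CB s s (.present i (remaining s i j)))) ∧
    (∀ i j, i ≤ Q.MA → ∀ t, Q.pay Q.RB Q.CB s t (review s t i j)
      ≤ Q.pay Q.RB Q.CB s s (review s s i j)) := by
  constructor
  · rintro ⟨-, h1, h2⟩
    simp only [forall_lt_naor_iff, payoffB_eq, EReal.coe_nonneg, EReal.coe_le_coe_iff] at h1 h2
    exact ⟨h1, h2⟩
  · rintro ⟨h1, h2⟩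
    refine ⟨fun n => (Q.payoffA_nonneg_iff n).symm, ?_, ?_⟩
    · simpa only [forall_lt_naor_iff, payoffB_eq, EReal.coe_nonneg] using h1
    · simpa only [forall_lt_naor_iff, payoffB_eq, EReal.coe_le_coe_iff] using h2

/-- Two equilibria in which the `A`-customers use Naor's strategy agree in all relevant states. -/
theorem IsEquilibrium.iff_of_naor {s s' : StrategyB} (hs : Q.IsEquilibrium Q.naor s)
    (hs' : Q.IsEquilibrium Q.naor s') {i : ℕ} (hi : i ≤ Q.MA) (j : ℕ) : s i j ↔ s' i j := by
  rw [isEquilibrium_naor_iff] at hs hs'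
  -- Playing `s'` among users of `s` is a deviation, hence no better than `s`; by agreement further
  -- ahead it earns what `s'` earns among its own users.
  have hle : ∀ {s s' : StrategyB} {J : ℕ}, (∀ i k, i ≤ Q.MA → k < J → (s i k ↔ s' i k)) →
      (∀ i j, i ≤ Q.MA → ∀ t, Q.pay Q.RB Q.CB s t (review s t i j)
        ≤ Q.pay Q.RB Q.CB s s (review s s i j)) → ∀ i j, i ≤ Q.MA → j ≤ J →
      Q.pay Q.RB Q.CB s' s' (review s' s' i j) ≤ Q.pay Q.RB Q.CB s s (review s s i j) := by
    intro s s' J hJ hbest i j hi hj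
    refine le_of_eq_of_le ?_ (hbest i j hi s')
    rw [← review_congr (fun k hk => hJ i k hi (hk.trans_le hj)) s']
    exact (pay_congr hJ _ _ _ (whilePresent_review fun _ =>
      ⟨hi, (remaining_le _ _ _).trans hj⟩)).symm
  induction j using Nat.strong_induction_on generalizing i with
  | _ j ih =>
  have hJ : ∀ i k, i ≤ Q.MA → k < j → (s i k ↔ s' i k) := fun i k hi hk => ih k hk hi
  have hV : ∀ i' j', i' ≤ Q.MA → j' ≤ j → Q.pay Q.RB Q.CB s s (review s s i' j')
      = Q.pay Q.RB Q.CB s' s' (review s' s' i' j') := fun i' j' hi' hj' =>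
    le_antisymm (hle (fun i k hi hk => (hJ i k hi hk).symm) hs'.2 i' j' hi' hj')
      (hle hJ hs.2 i' j' hi' hj')
  have hstep : ∀ j' ≤ j, ∀ e, Q.pay Q.RB Q.CB s s (stepB Q.naor s s e (.present i j'))
      = Q.pay Q.RB Q.CB s' s' (stepB Q.naor s' s' e (.present i j')) := by
    intro j' hj' e
    rcases Q.stepB_present hi j' e with hst | ⟨i', hi', j'', hj'', hst⟩
    · rw [hst, hst, pay_served, pay_served]
    · rw [hst, hst, hV i' j'' hi' (hj''.trans hj')]
  -- Staying until the next event is worth a mean of continuation values, which coincide for `s` and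
  -- `s'`; so the staying conditions coincide too.
  rw [hs.1 i j hi, hs'.1 i j hi, ← remaining_congr fun k hk => hJ i k hi hk, pay_present,
    hstep _ (remaining_le _ _ _), hstep _ (remaining_le _ _ _), ← pay_present]

/-! ### The threshold profile is an equilibrium. -/

section Threshold

variable {v : ℕ} {s : StrategyB}

lemma pay_threshold (hs : Q.IsThreshold v s) {x : StatusB}
    (hx : WhilePresent (fun i j => i ≤ Q.MA ∧ i + j < Q.MA + v + 1) x) :
    Q.pay Q.RB Q.CB s s x = Q.value v x := by
  have hG : ∀ e x, WhilePresent (fun i j => i ≤ Q.MA ∧ i + j < Q.MA + v + 1) x →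
      WhilePresent (fun i j => i ≤ Q.MA ∧ i + j < Q.MA + v + 1) (stepB Q.naor s s e x) :=
    fun e x hx => whilePresent_stepB (fun i j h => h.1)
      (fun i j i' j' _ hi' _ ht => ⟨hi', (hs _ _ hi').mp ht⟩) e hx
  exact Q.pay_eq_of_mean _ (I := Q.MA) (J := Q.MA + v) (fun i j h => ⟨h.1, by have := h.2; omega⟩)
    (fun x hx => ⟨hG _ x hx, hG _ x hx⟩) rfl rfl (fun i j h => value_mean hs h.1 h.2) hx

lemma pay_le_value (hs : Q.IsThreshold v s) (h0 : 0 ≤ Q.surplus v)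
    (h1 : Q.surplus (v + 1) < 0) (t : StrategyB) {x : StatusB}
    (hx : WhilePresent (fun i j => i ≤ Q.MA ∧ i + j ≤ Q.MA + v + 1) x) :
    Q.pay Q.RB Q.CB s t x ≤ Q.value v x := by
  have hG : ∀ e x, WhilePresent (fun i j => i ≤ Q.MA ∧ i + j ≤ Q.MA + v + 1) x →
      WhilePresent (fun i j => i ≤ Q.MA ∧ i + j ≤ Q.MA + v + 1) (stepB Q.naor s t e x) :=
    fun e x hx => whilePresent_stepB (fun i j h => h.1)
      -- Those ahead still obey the threshold, so even a deviator who never leaves is at most at the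
      -- threshold position after each review.
      (fun i j i' j' _ hi' _ _ => ⟨hi', by rw [remaining_threshold hs hi']; omega⟩) e hx
  refine Q.pay_le_of_supermean (w := Q.value v) _ (I := Q.MA) (J := Q.MA + v + 1)
    (fun i j h => ⟨h.1, by have := h.2; omega⟩)
    (fun x hx => ⟨hG _ x hx, hG _ x hx⟩) le_rfl le_rfl (fun i j h => ?_) hx
  have e1 := mul_le_mul_of_nonneg_left (value_stepB_le hs h0 t h.1 j True) Q.p_nonneg
  have e2 := mul_le_mul_of_nonneg_left (value_stepB_le hs h0 t h.1 j False) Q.q_nonneg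
  -- Below the threshold following `s` attains the mean; at it, staying has negative mean while
  -- `value` is nonnegative.
  rcases h.2.lt_or_eq with h' | h'
  · linarith [value_mean hs h.1 h']
  · linarith [value_threshold_mean_neg hs h1 h.1 h', value_nonneg h0 h.1 j]

theorem isEquilibrium_of_isThreshold (hs : Q.IsThreshold v s) (h0 : 0 ≤ Q.surplus v)
    (h1 : Q.surplus (v + 1) < 0) : Q.IsEquilibrium Q.naor s := by
  have hself : ∀ i j, i ≤ Q.MA →
      Q.pay Q.RB Q.CB s s (review s s i j) = Q.value v (review s s i j) := fun i j hi =>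
    pay_threshold hs (whilePresent_review fun ht => ⟨hi, (hs _ _ hi).mp ht⟩)
  rw [isEquilibrium_naor_iff]
  refine ⟨fun i j hi => ?_, fun i j hi t => ?_⟩
  · rw [hs i j hi, remaining_threshold hs hi]
    rcases lt_or_ge (i + j) (Q.MA + v + 1) with h | h
    · rw [min_eq_left (by omega), pay_threshold hs (x := .present i j) ⟨hi, h⟩]
      exact iff_of_true h (value_nonneg h0 hi j)
    · rw [min_eq_right (by omega)]
      refine iff_of_false (by omega) (not_le.mpr ?_)
      -- The threshold state is outside the scope of `pay_threshold`, but the states after the next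
      -- event and review are covered.
      have hst : ∀ e, Q.pay Q.RB Q.CB s s
          (stepB Q.naor s s e (.present i (Q.MA + v + 1 - i)))
          = Q.value v (stepB Q.naor s s e (.present i (Q.MA + v + 1 - i))) := by
        intro e
        rcases Q.stepB_present hi (Q.MA + v + 1 - i) e with hst | ⟨i', hi', j', -, hst⟩
        · rw [hst, pay_served]
          rfl
        · rw [hst, hself i' j' hi']
      rw [pay_present, hst, hst]
      exact value_threshold_mean_neg hs h1 hi (by omega)
  · rw [hself i j hi]
    refine le_trans ?_ (value_review_le hs h0 t hi j)
    refine pay_le_value hs h0 h1 t (whilePresent_review fun _ => ⟨hi, ?_⟩)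
    rw [remaining_threshold hs hi]
    omega

end Threshold

/-! ### The closed form of the threshold. -/

/-- Expected time in the system when nobody reneges. -/
lemma timeB_eq_stayTime {i : ℕ} (hi : i ≤ Q.MA) (j : ℕ) :
    Q.timeB (fun _ _ => True) (fun _ _ => True) (.present i j) = ENNReal.ofReal (Q.stayTime i j) := by
  set s : StrategyB := fun _ _ => True
  have hrem : ∀ i j, remaining s i j = j := by
    intro i j
    induction j with
    | zero => rfl
    | succ j ih => simp [remaining, ih, s]
  have hrev : ∀ i j, review s s i j = .present i j := fun i j => by simp [review, hrem, s]
  have hG : ∀ e x, WhilePresent (fun i' j' => i' ≤ Q.MA ∧ j' ≤ j) x →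
      WhilePresent (fun i' j' => i' ≤ Q.MA ∧ j' ≤ j) (stepB Q.naor s s e x) := fun e x hx =>
    whilePresent_stepB (fun _ _ h => h.1)
      (fun _ _ _ _ h hi' hj' _ => ⟨hi', (remaining_le _ _ _).trans (hj'.trans h.2)⟩) e hx
  -- With reward `0` and unit cost `1` the payoff is minus the expected time.
  have key := Q.pay_eq_of_mean (R := 0) (C := 1) (s := s) (t := s)
    (w := fun x => -Q.stayTimeOf x) _ (I := Q.MA) (J := j) (fun _ _ h => h)
    (fun x hx => ⟨hG _ x hx, hG _ x hx⟩) (by simp [stayTimeOf]) (by simp [stayTimeOf]) ?_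
    (x := .present i j) ⟨hi, le_rfl⟩
  · rw [← ENNReal.ofReal_toReal (Q.timeB_ne_top s s (.present i j))]
    congr 1
    simpa [pay, stayTimeOf] using key
  · intro i j hij
    have hy : Q.stayTime i j = Q.stayTimeOf (stepB Q.naor s s False (.present i j))
        + Q.tau (Q.MA - i) := by
      match i, j with
      | i + 1, j => rw [stepB_false_succ, hrev]; exact Q.stayTime_succ_left i j
      | 0, j + 1 => rw [stepB_false_zero_succ, hrev]; exact Q.stayTime_zero_succ j
      | 0, 0 => rw [stepB_false_zero_zero]; simp [stayTimeOf, stayTime_zero_zero]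
    by_cases h : i < Q.MA
    · rw [stepB_true_of_join Q.naor _ _ h, hrev]
      have := Q.stayTime_join h hy
      simp only [stayTimeOf] at *
      linarith
    · rw [stepB_true_of_balk Q.naor _ _ h, hrev]
      have := Q.stayTime_balk h hy
      simp only [stayTimeOf] at *
      linarith

lemma fullTimeB_eq (j : ℕ) : Q.fullTimeB Q.MA j = ENNReal.ofReal (Q.stayTime Q.MA j) := by
  rw [fullTimeB, expTimeB_eq, timeB_eq_stayTime le_rfl]

lemma mu_mul_tau (m : ℕ) : Q.mu * Q.tau m = ∑ k ∈ Finset.range (m + 1), Q.rhoA ^ k := by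
  have hmu := Q.mu_pos.ne'
  induction m with
  | zero => simpa using Q.mu_mul_tau_zero
  | succ m ih =>
    rw [mu_mul_tau_succ, Finset.sum_range_succ', pow_zero, add_comm]
    congr 1
    simp_rw [pow_succ']
    rw [← Finset.mul_sum, ← ih, rhoA]
    field_simp

/-- Here `surplus v ≥ 0` means `v + 1` is at most the quotient under the floor; multiplying through
by `mu` turns each `tau` into a geometric sum. -/
lemma Ve_eq_floor : Q.Ve = ⌊(Q.RB / Q.CB - ∑ m ∈ Finset.range Q.MA, Q.tau m) / Q.tau Q.MA⌋ := by
  have hmu := Q.mu_pos.ne'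
  have hC := Q.CB_pos.ne'
  have ht := (Q.tau_pos Q.MA).ne'
  have e : (Q.RB / Q.CB - ∑ m ∈ Finset.range Q.MA, Q.tau m) / Q.tau Q.MA
      = (Q.RB * Q.mu / Q.CB - ∑ m ∈ Finset.range Q.MA, Q.mu * Q.tau m) / (Q.mu * Q.tau Q.MA) := by
    rw [← Finset.mul_sum]
    field_simp
  rw [e, Ve]
  simp_rw [mu_mul_tau]
  split_ifs with h
  · have h1 : 1 - Q.rhoA ≠ 0 := sub_ne_zero.mpr (Ne.symm h)
    have hgeom : ∀ n, ∑ k ∈ Finset.range n, Q.rhoA ^ k = (1 - Q.rhoA ^ n) / (1 - Q.rhoA) :=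
      fun n => by rw [geom_sum_eq h, ← neg_div_neg_eq, neg_sub, neg_sub]
    have hsum : ∑ m ∈ Finset.range Q.MA, ∑ k ∈ Finset.range (m + 1), Q.rhoA ^ k
        = 1 / (1 - Q.rhoA) * (Q.MA - Q.rhoA / (1 - Q.rhoA) * (1 - Q.rhoA ^ Q.MA)) := by
      simp_rw [hgeom, pow_succ']
      rw [← Finset.sum_div, Finset.sum_sub_distrib, ← Finset.mul_sum, hgeom]
      simp
      ring
    rw [hsum, hgeom, div_div_eq_mul_div]
    congr 1
    ring
  · push Not at h
    have hsum : ∀ n : ℕ, ∑ m ∈ Finset.range n, ((m : ℝ) + 1) = n * (n + 1) / 2 := by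
      intro n
      induction n with
      | zero => simp
      | succ n ih => rw [Finset.sum_range_succ, ih]; push_cast; ring
    simp only [h, one_pow, Finset.sum_const, Finset.card_range, nsmul_eq_mul, mul_one]
    push_cast
    rw [hsum]
    congr 1
    have : (Q.MA : ℝ) + 1 ≠ 0 := by positivity
    field_simp

/-- `Te` exceeds `MA` by the number of positions in which a `B`-customer is willing to stay forever
with `MA` customers of class `A` ahead. -/
lemma exists_Te_eq (hQ : Q.fullTimeB Q.MA 0 ≤ ENNReal.ofReal (Q.RB / Q.CB)) :
    ∃ v : ℕ, Q.Te = ((Q.MA + v + 1 : ℕ) : ℤ) ∧ 0 ≤ Q.surplus v ∧ Q.surplus (v + 1) < 0 := by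
  have hC := Q.CB_pos
  have ht := Q.tau_pos Q.MA
  rw [fullTimeB_eq, ENNReal.ofReal_le_ofReal_iff (div_pos Q.RB_pos hC).le, stayTime_MA] at hQ
  -- The hypothesis on the full time says `surplus 0 ≥ 0`, which makes `v = Ve - 1` a natural
  -- number.
  have hV : 1 ≤ Q.Ve := by
    rw [Ve_eq_floor, Int.le_floor, le_div_iff₀ ht]
    push_cast at hQ ⊢
    linarith
  obtain ⟨v, hv⟩ := Int.eq_ofNat_of_zero_le (sub_nonneg.mpr hV)
  have hv' : Q.Ve = (v : ℤ) + 1 := by linarith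
  refine ⟨v, by rw [Te, hv']; push_cast; ring, ?_⟩
  obtain ⟨hl, hu⟩ := Int.floor_eq_iff.mp (Q.Ve_eq_floor.symm.trans hv')
  rw [le_div_iff₀ ht, le_sub_iff_add_le, le_div_iff₀ hC] at hl
  rw [div_lt_iff₀ ht, sub_lt_iff_lt_add, div_lt_iff₀ hC] at hu
  push_cast at hl hu
  simp only [surplus, stayTime_MA]
  push_cast
  constructor <;> linarith

end Params

end StrategicQueue

/-! ### Conclusion. -/

theorem mainTheorem1 (Q : StrategicQueue.Params)
    (hQ : Q.fullTimeB Q.MA 0 ≤ ENNReal.ofReal (Q.RB / Q.CB))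
    (a : StrategicQueue.StrategyA) (s : StrategicQueue.StrategyB) :
    Q.IsEquilibrium a s ↔
      (∀ n, a n ↔ n < Q.MA) ∧
      (∀ nA nB, nA ≤ Q.MA → (s nA nB ↔ ((nA + nB : ℕ) : ℤ) < Q.Te)) := by
  obtain ⟨v, hT, h0, h1⟩ := StrategicQueue.Params.exists_Te_eq hQ
  have hthr : (∀ nA nB, nA ≤ Q.MA → (s nA nB ↔ ((nA + nB : ℕ) : ℤ) < Q.Te))
      ↔ Q.IsThreshold v s := by
    simp only [hT, Nat.cast_lt]
    rfl
  rw [hthr]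
  have hnaor : (∀ n, a n ↔ n < Q.MA) → a = Q.naor := fun h => funext fun n => propext (h n)
  constructor
  · intro h
    have ha : ∀ n, a n ↔ n < Q.MA := fun n => (h.joinA n).trans (Q.payoffA_nonneg_iff n)
    obtain rfl := hnaor ha
    -- The explicit threshold strategy is one equilibrium; uniqueness transfers its form to `s`.
    have hc : Q.IsThreshold v fun i j => i + j < Q.MA + v + 1 := fun _ _ _ => Iff.rfl
    exact ⟨ha, fun i j hi =>
      h.iff_of_naor (StrategicQueue.Params.isEquilibrium_of_isThreshold hc h0 h1) hi j⟩
  · rintro ⟨ha, hs⟩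
    obtain rfl := hnaor ha
    exact StrategicQueue.Params.isEquilibrium_of_isThreshold hs h0 h1
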